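/- Fix an alphabet $\Sigma$ (finite or infinite). **Lo-sets and precubes.** A *lo-set* is a finite set $U$ with a strict total order $\dashrightarrow$ and a labelling $\lambda:U\to\Sigma$; an *ilo-set* ${}_SU_T$ is a lo-set $U$ with subsets $S,T\subseteq U$. Let $\mathrm{I}\square$ be the category of isomorphism classes of ilo-sets whose morphisms are *coface maps* $d_{A,B}:{}_{S}U_{T}\to{}_{S'}V_{T'}$: order- and label-preserving maps $\partial:U\to V$ with disjoint $A,B\subseteq V$ such that $\partial(U)=V\setminus(A\cup B)$, $A\cap S'=\emptyset=B\cap T'$, $S=\partial^{-1}(S')$ and $T=\partial^{-1}(T')$. Composition is $d_{C,D}\circ d_{A,B}=d_{\partial(A)\cup C,\,\partial(B)\cup D}$, where $\partial$ is the map underlying $d_{C,D}$. Let $\square$ be the analogous category of lo-sets without interfaces. Write $d^0_A=d_{A,\emptyset}$ and $d^1_B=d_{\emptyset,B}$. **(i)HDAs.** An *HDA* is a presheaf $X$ on $\square$ with finitely many cells (elements of the sets $X[U]$), together with sets $X_\bot$ and $X^\top$ of start and accept cells. An *iHDA* is a presheaf $X$ on $\mathrm{I}\square$ with finitely many cells and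 sets $X_\bot,X^\top$ of cells such that $S=U$ whenever $X_\bot$ contains a cell in $X[{}_SU_T]$ and $T=U$ whenever $X^\top$ contains a cell in $X[{}_SU_T]$. Write $\delta^\nu_A=X[d^\nu_A]$, and $\mathrm{ev}(x)=U$ if $x\in X[U]$ or $x\in X[{}_SU_T]$. **Ipomsets.** A *labelled iposet* $(P,<,\dashrightarrow,S,T,\lambda)$ is a finite set $P$ with two strict partial orders such that any two distinct elements are comparable by $<$ or by $\dashrightarrow$, a labelling $\lambda:P\to\Sigma$, a set $S$ of $<$-minimal elements and a set $T$ of $<$-maximal elements. A *subsumption* $P\to Q$ is a label-preserving bijection $f$ with $f(S_P)=S_Q$ and $f(T_P)=T_Q$ such that $f(x)<_Qf(y)$ implies $x<_Py$, and such that $x\dashrightarrow_Py$ with $x,y$ $<_P$-incomparable implies $f(x)\dashrightarrow_Qf(y)$. It is an *isomorphism* if moreover $x<_Py$ implies $f(x)<_Qf(y)$; thus the event order $\dashrightarrow$ of $<$-comparable elements is immaterial. An *ipomset* is an isomorphism class of labelled iposets; $P\sqsubseteq Q$ means that there is a subsumption $P\to Q$. $P$ is an *interval ipomset* if there are $b,e:P\to\mathbb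 R$ with $b(x)\le e(x)$ for all $x$ and $x<y\iff e(x)<b(y)$ for all $x,y$. An ilo-set ${}_SU_T$ is an ipomset with empty $<$. If the lo-sets $T_P$ and $S_Q$ are isomorphic, the *gluing* $P*Q$ is obtained from $P\sqcup Q$ by identifying $T_P$ with $S_Q$ along the unique isomorphism, with source interface $S_P$, target interface $T_Q$, event order the transitive closure of ${\dashrightarrow_P}\cup{\dashrightarrow_Q}$, and $x<y$ iff $x<_Py$, or $x<_Qy$, or $x\in P\setminus T_P$ and $y\in Q\setminus S_Q$. **Paths and languages.** A *path* in $X$ is a sequence $(x_0,\phi_1,x_1,\dots,\phi_n,x_n)$ of cells $x_k$, over objects $U_k$, such that each $\phi_k$ is either an up-step $d^0_A:U_{k-1}\to U_k$ with $x_{k-1}=\delta^0_A(x_k)$, or a down-step $d^1_B:U_k\to U_{k-1}$ with $x_k=\delta^1_B(x_{k-1})$. An up-step has the ipomset ${}_{V\setminus A}V_V$ with $V=\mathrm{ev}(x_k)$, a down-step the ipomset ${}_{V}V_{V\setminus B}$ with $V=\mathrm{ev}(x_{k-1})$. The event ipomset $\mathrm{ev}(\alpha)$ of a path $\alpha$ is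 the gluing of the ipomsets of its steps, in order, and ${}_VV_V$ with $V=\mathrm{ev}(x_0)$ if $\alpha=(x_0)$. A path is *accepting* if $x_0\in X_\bot$ and $x_n\in X^\top$, and $\mathrm{Lang}(X)=\{\mathrm{ev}(\alpha)\mid\alpha\text{ is an accepting path in }X\}$. **Proposition.** For every HDA and every iHDA $X$, $\mathrm{Lang}(X)$ is a language: every element of $\mathrm{Lang}(X)$ is an interval ipomset, and if $P$ is an interval ipomset, $Q\in\mathrm{Lang}(X)$ and $P\sqsubseteq Q$, then $P\in\mathrm{Lang}(X)$. -/

import Mathlib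

open CategoryTheory Opposite

universe v w

/-! ### Labelled precube categories -/

/-- A word over the alphabet `Act`, viewed as the lo-set `0 < 1 < ... < n - 1` labelled by `lab`.
These represent the isomorphism classes of lo-sets and are the objects of `□`. -/
structure LoWord (Act : Type v) where
  n : ℕ
  lab : Fin n → Act

/-- A coface map `d_{A,B} : U → V`: the lo-map `∂_{A ∪ B}`, with image the complement of `A ∪ B`,
the set `A` of unstarted events and the set `B` of terminated events. -/
@[ext]
structure Coface {Act : Type v} (U V : LoWord Act) where
  emb : Fin U.n ↪o Fin V.n
  lab_emb : ∀ i, V.lab (emb i) = U.lab i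
  A : Set (Fin V.n)
  B : Set (Fin V.n)
  disj : Disjoint A B
  range_emb : Set.range emb = (A ∪ B)ᶜ

namespace Coface

variable {Act : Type v} {U V W : LoWord Act}

theorem emb_notMem_A (d : Coface U V) (i : Fin U.n) : d.emb i ∉ d.A := fun h => by
  have : d.emb i ∈ (d.A ∪ d.B)ᶜ := d.range_emb ▸ Set.mem_range_self i
  exact this (Or.inl h)

theorem emb_notMem_B (d : Coface U V) (i : Fin U.n) : d.emb i ∉ d.B := fun h => by
  have : d.emb i ∈ (d.A ∪ d.B)ᶜ := d.range_emb ▸ Set.mem_range_self i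
  exact this (Or.inr h)

theorem exists_emb (d : Coface U V) (j : Fin V.n) (hA : j ∉ d.A) (hB : j ∉ d.B) :
    ∃ i, d.emb i = j := by
  have : j ∈ Set.range d.emb := by
    rw [d.range_emb]; rintro (h | h) <;> contradiction
  exact this

/-- The identity `d_{∅,∅}`. -/
def id (U : LoWord Act) : Coface U U where
  emb := RelEmbedding.refl _
  lab_emb _ := rfl
  A := ∅
  B := ∅
  disj := disjoint_bot_left
  range_emb := by ext x; simp

/-- `d_{C,D} ∘ d_{A,B} = d_{∂(A) ∪ C, ∂(B) ∪ D}` with `∂ = ∂_{C ∪ D}`. -/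
def comp (d : Coface U V) (e : Coface V W) : Coface U W where
  emb := d.emb.trans e.emb
  lab_emb i := (e.lab_emb _).trans (d.lab_emb i)
  A := e.emb '' d.A ∪ e.A
  B := e.emb '' d.B ∪ e.B
  disj := by
    rw [Set.disjoint_left]
    rintro _ (⟨i, hi, rfl⟩ | hx) (⟨j, hj, hji⟩ | hy)
    · rw [e.emb.injective hji] at hj
      exact Set.disjoint_left.1 d.disj hi hj
    · exact e.emb_notMem_B i hy
    · exact e.emb_notMem_A j (hji ▸ hx)
    · exact Set.disjoint_left.1 e.disj hx hy
  range_emb := by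
    ext x
    constructor
    · rintro ⟨i, rfl⟩
      rintro ((⟨j, hj, hji⟩ | h) | (⟨j, hj, hji⟩ | h))
      · exact d.emb_notMem_A i (e.emb.injective hji ▸ hj)
      · exact e.emb_notMem_A _ h
      · exact d.emb_notMem_B i (e.emb.injective hji ▸ hj)
      · exact e.emb_notMem_B _ h
    · intro hx
      obtain ⟨j, rfl⟩ := e.exists_emb x (fun h => hx (Or.inl (Or.inr h)))
        (fun h => hx (Or.inr (Or.inr h)))
      obtain ⟨i, rfl⟩ := d.exists_emb j (fun h => hx (Or.inl (Or.inl ⟨j, h, rfl⟩)))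
        (fun h => hx (Or.inr (Or.inl ⟨j, h, rfl⟩)))
      exact ⟨i, rfl⟩

end Coface

/-- The labelled precube category `□`. -/
instance LoWord.category (Act : Type v) : Category.{0} (LoWord Act) where
  Hom := Coface
  id := Coface.id
  comp := Coface.comp
  id_comp d := by
    refine Coface.ext ?_ ?_ ?_
    · ext i; rfl
    · simp [Coface.comp, Coface.id]
    · simp [Coface.comp, Coface.id]
  comp_id d := by
    refine Coface.ext ?_ ?_ ?_
    · ext i; rfl
    · ext x; simp [Coface.comp, Coface.id]
    · ext x; simp [Coface.comp, Coface.id]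
  assoc d e f := by
    refine Coface.ext ?_ ?_ ?_
    · ext i; rfl
    · simp [Coface.comp, Set.image_union, Set.image_image, Set.union_assoc]
    · simp [Coface.comp, Set.image_union, Set.image_image, Set.union_assoc]

/-- A lo-set with source interface `S` and target interface `T`, on a word over `Act`.
These represent the isomorphism classes of ilo-sets and are the objects of `I□`. -/
structure IloWord (Act : Type v) where
  lo : LoWord Act
  S : Set (Fin lo.n)
  T : Set (Fin lo.n)

/-- A coface map of ilo-sets. -/
@[ext]
structure ICoface {Act : Type v} (U V : IloWord Act) where
  base : Coface U.lo V.lo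
  preimage_S : U.S = base.emb ⁻¹' V.S
  preimage_T : U.T = base.emb ⁻¹' V.T
  disj_S : Disjoint base.A V.S
  disj_T : Disjoint base.B V.T

/-- The labelled precube category with interfaces `I□`. -/
instance IloWord.category (Act : Type v) : Category.{0} (IloWord Act) where
  Hom := ICoface
  id U :=
    { base := Coface.id U.lo
      preimage_S := rfl
      preimage_T := rfl
      disj_S := disjoint_bot_left
      disj_T := disjoint_bot_left }
  comp {U V W} d e :=
    { base := d.base.comp e.base
      preimage_S := by rw [d.preimage_S, e.preimage_S]; rfl
      preimage_T := by rw [d.preimage_T, e.preimage_T]; rfl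
      disj_S := by
        rw [Set.disjoint_left]
        rintro _ (⟨i, hi, rfl⟩ | hx) hS
        · refine Set.disjoint_left.1 d.disj_S hi ?_
          rw [e.preimage_S]; exact hS
        · exact Set.disjoint_left.1 e.disj_S hx hS
      disj_T := by
        rw [Set.disjoint_left]
        rintro _ (⟨i, hi, rfl⟩ | hx) hT
        · refine Set.disjoint_left.1 d.disj_T hi ?_
          rw [e.preimage_T]; exact hT
        · exact Set.disjoint_left.1 e.disj_T hx hT }
  id_comp d := ICoface.ext (Category.id_comp (X := LoWord.mk _ _) (Y := LoWord.mk _ _) d.base)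
  comp_id d := ICoface.ext (Category.comp_id (X := LoWord.mk _ _) (Y := LoWord.mk _ _) d.base)
  assoc d e f := ICoface.ext (Category.assoc (W := LoWord.mk _ _) (X := LoWord.mk _ _)
    (Y := LoWord.mk _ _) (Z := LoWord.mk _ _) d.base e.base f.base)

/-- The functor `I□ → □` that forgets the interfaces. -/
def IloWord.forget (Act : Type v) : IloWord Act ⥤ LoWord Act where
  obj U := U.lo
  map d := d.base

/-! ### Higher-dimensional automata -/

/-- The cells of a presheaf. -/
abbrev Cell {C : Type v} [Category.{0} C] (X : Cᵒᵖ ⥤ Type w) : Type (max v w) :=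
  Σ U : C, X.obj (op U)

/-- A higher-dimensional automaton over the alphabet `Act`. -/
structure HDA (Act : Type v) where
  X : (LoWord Act)ᵒᵖ ⥤ Type w
  finite : Finite (Cell X)
  start : Set (Cell X)
  accept : Set (Cell X)

/-- A higher-dimensional automaton with interfaces over the alphabet `Act`. -/
structure IHDA (Act : Type v) where
  X : (IloWord Act)ᵒᵖ ⥤ Type w
  finite : Finite (Cell X)
  start : Set (Cell X)
  accept : Set (Cell X)
  start_S : ∀ x ∈ start, x.1.S = Set.univ
  accept_T : ∀ x ∈ accept, x.1.T = Set.univ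

/-! ### Ipomsets -/

/-- A labelled iposet: precedence order `prec`, event order `evt`, interfaces `S` and `T`. -/
structure Iposet (Act : Type v) where
  carrier : Type
  finite : Finite carrier
  prec : carrier → carrier → Prop
  evt : carrier → carrier → Prop
  S : Set carrier
  T : Set carrier
  lab : carrier → Act
  prec_irrefl : ∀ x, ¬ prec x x
  prec_trans : ∀ x y z, prec x y → prec y z → prec x z
  evt_irrefl : ∀ x, ¬ evt x x
  evt_trans : ∀ x y z, evt x y → evt y z → evt x z
  comparable : ∀ x y, x = y ∨ prec x y ∨ prec y x ∨ evt x y ∨ evt y x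
  S_minimal : ∀ x ∈ S, ∀ y, ¬ prec y x
  T_maximal : ∀ x ∈ T, ∀ y, ¬ prec x y

namespace Iposet

variable {Act : Type v}

/-- The bijection `f` is a subsumption from `P` to `Q`. -/
structure IsSubsumption (P Q : Iposet Act) (f : P.carrier ≃ Q.carrier) : Prop where
  lab : ∀ x, Q.lab (f x) = P.lab x
  image_S : f '' P.S = Q.S
  image_T : f '' P.T = Q.T
  reflects_prec : ∀ x y, Q.prec (f x) (f y) → P.prec x y
  preserves_evt : ∀ x y, P.evt x y → ¬ P.prec x y → ¬ P.prec y x → Q.evt (f x) (f y)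

/-- `P ⊑ Q`: there is a subsumption from `P` to `Q`. -/
def Subsumed (P Q : Iposet Act) : Prop := ∃ f, IsSubsumption P Q f

/-- `P ≅ Q`: there is a subsumption from `P` to `Q` that is an isomorphism for the precedence
orders. It then preserves and reflects the event order of incomparable elements (see `Iso.symm`);
the event order of elements that are already ordered by precedence is immaterial. -/
def Iso (P Q : Iposet Act) : Prop :=
  ∃ f, IsSubsumption P Q f ∧ ∀ x y, P.prec x y ↔ Q.prec (f x) (f y)

theorem IsSubsumption.comp {P Q R : Iposet Act} {f : P.carrier ≃ Q.carrier}
    {g : Q.carrier ≃ R.carrier} (hf : IsSubsumption P Q f) (hg : IsSubsumption Q R g) :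
    IsSubsumption P R (f.trans g) where
  lab x := (hg.lab _).trans (hf.lab x)
  image_S := by rw [← hg.image_S, ← hf.image_S, Set.image_image]; rfl
  image_T := by rw [← hg.image_T, ← hf.image_T, Set.image_image]; rfl
  reflects_prec x y h := hf.reflects_prec x y (hg.reflects_prec _ _ h)
  preserves_evt x y h h1 h2 := hg.preserves_evt _ _ (hf.preserves_evt x y h h1 h2)
    (fun h => h1 (hf.reflects_prec _ _ h)) (fun h => h2 (hf.reflects_prec _ _ h))

theorem Subsumed.trans {P Q R : Iposet Act} (h : P.Subsumed Q) (h' : Q.Subsumed R) :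
    P.Subsumed R := by
  obtain ⟨f, hf⟩ := h
  obtain ⟨g, hg⟩ := h'
  exact ⟨_, hf.comp hg⟩

theorem Iso.subsumed {P Q : Iposet Act} (h : P.Iso Q) : P.Subsumed Q := by
  obtain ⟨f, hf, -⟩ := h
  exact ⟨f, hf⟩

theorem Iso.refl (P : Iposet Act) : P.Iso P :=
  ⟨Equiv.refl _, ⟨fun _ => rfl, by simp, by simp, fun _ _ h => h, fun _ _ h _ _ => h⟩,
    fun _ _ => Iff.rfl⟩

theorem Iso.symm {P Q : Iposet Act} (h : P.Iso Q) : Q.Iso P := by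
  obtain ⟨f, hf, hp⟩ := h
  have hp' : ∀ x y, Q.prec x y ↔ P.prec (f.symm x) (f.symm y) := fun x y => by simp [hp]
  refine ⟨f.symm, ⟨fun x => ?_, ?_, ?_, fun x y h => (hp' x y).2 h, fun x y h h1 h2 => ?_⟩, hp'⟩
  · rw [← hf.lab]; simp
  · rw [← hf.image_S]; simp
  · rw [← hf.image_T]; simp
  · rw [hp'] at h1 h2
    rcases P.comparable (f.symm x) (f.symm y) with e | e | e | e | e
    · rw [f.symm.injective e] at h; exact (Q.evt_irrefl _ h).elim
    · exact (h1 e).elim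
    · exact (h2 e).elim
    · exact e
    · have := hf.preserves_evt _ _ e h2 h1
      simp only [Equiv.apply_symm_apply] at this
      exact (Q.evt_irrefl _ (Q.evt_trans _ _ _ h this)).elim

theorem Iso.trans {P Q R : Iposet Act} (h : P.Iso Q) (h' : Q.Iso R) : P.Iso R := by
  obtain ⟨f, hf, hp⟩ := h
  obtain ⟨g, hg, hq⟩ := h'
  exact ⟨_, hf.comp hg, fun x y => (hp x y).trans (hq _ _)⟩

/-- `P` admits an interval representation. -/
def IsInterval (P : Iposet Act) : Prop :=
  ∃ b e : P.carrier → ℝ, (∀ x, b x ≤ e x) ∧ ∀ x y, P.prec x y ↔ e x < b y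

theorem Iso.isInterval {P Q : Iposet Act} (h : P.Iso Q) (hP : P.IsInterval) : Q.IsInterval := by
  obtain ⟨f, -, hp⟩ := h.symm
  obtain ⟨b, e, hbe, hpe⟩ := hP
  exact ⟨b ∘ f, e ∘ f, fun x => hbe _, fun x y => (hp x y).trans (hpe _ _)⟩

instance setoid (Act : Type v) : Setoid (Iposet Act) where
  r := Iso
  iseqv := ⟨Iso.refl, Iso.symm, Iso.trans⟩

end Iposet

/-- Ipomsets: isomorphism classes of labelled iposets. -/
def Ipomset (Act : Type v) : Type (max v 1) := Quotient (Iposet.setoid Act)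

namespace Ipomset

variable {Act : Type v}

/-- The ipomset of a labelled iposet. -/
def mk (P : Iposet Act) : Ipomset Act := Quotient.mk _ P

/-- Subsumption of ipomsets. -/
def Subsumed : Ipomset Act → Ipomset Act → Prop :=
  Quotient.lift₂ Iposet.Subsumed fun _ _ _ _ h h' => propext
    ⟨fun k => (Iposet.Iso.subsumed (Iposet.Iso.symm h)).trans (k.trans (Iposet.Iso.subsumed h')),
     fun k => (Iposet.Iso.subsumed h).trans
       (k.trans (Iposet.Iso.subsumed (Iposet.Iso.symm h')))⟩

/-- Interval ipomsets. -/
def IsInterval : Ipomset Act → Prop :=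
  Quotient.lift Iposet.IsInterval fun _ _ h => propext
    ⟨Iposet.Iso.isInterval h, Iposet.Iso.isInterval (Iposet.Iso.symm h)⟩

/-- A language: a set of interval ipomsets that is down-closed, among the interval ipomsets,
under subsumption. -/
def IsLanguage (L : Set (Ipomset Act)) : Prop :=
  (∀ P ∈ L, P.IsInterval) ∧
    ∀ P Q : Ipomset Act, P.IsInterval → P.Subsumed Q → Q ∈ L → P ∈ L

end Ipomset

/-! ### Gluing composition -/

namespace Iposet

variable {Act : Type v}

/-- An isomorphism of lo-sets from the target interface of `P` to the source interface of `Q`. -/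
structure InterfaceIso (P Q : Iposet Act) where
  toEquiv : {x // x ∈ P.T} ≃ {y // y ∈ Q.S}
  evt_iff : ∀ x y, Q.evt (toEquiv x) (toEquiv y) ↔ P.evt x y
  lab_eq : ∀ x, Q.lab (toEquiv x) = P.lab x

namespace InterfaceIso

variable {P Q : Iposet Act} (f : InterfaceIso P Q)

/-- The carrier of the gluing. Every class of the quotient of `P ⊔ Q` by `x ≡ f x` has exactly
one representative that lies in `P` or in `Q ∖ S_Q`; `inl` and `inr` are the structural maps. -/
abbrev Carrier (_ : InterfaceIso P Q) : Type := P.carrier ⊕ {y : Q.carrier // y ∉ Q.S}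

/-- The structural map from `P` to the gluing. -/
def inl (x : P.carrier) : f.Carrier := Sum.inl x

open Classical in
/-- The structural map from `Q` to the gluing; it identifies `f x` with `x`. -/
noncomputable def inr (y : Q.carrier) : f.Carrier :=
  if h : y ∈ Q.S then Sum.inl (f.toEquiv.symm ⟨y, h⟩ : P.carrier) else Sum.inr ⟨y, h⟩

theorem inl_injective : Function.Injective f.inl := Sum.inl_injective

theorem inl_eq_inr {x : P.carrier} {y : Q.carrier} :
    f.inl x = f.inr y ↔ ∃ h : x ∈ P.T, (f.toEquiv ⟨x, h⟩ : Q.carrier) = y := by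
  unfold inl inr
  split_ifs with hy
  · constructor
    · intro h
      have := Sum.inl_injective h
      subst this
      exact ⟨(f.toEquiv.symm ⟨y, hy⟩).2, by simp⟩
    · rintro ⟨h, rfl⟩
      simp
  · simp only [false_iff]
    rintro ⟨h, rfl⟩
    exact hy (f.toEquiv ⟨x, h⟩).2

theorem inr_injective : Function.Injective f.inr := by
  intro x y h
  by_cases hx : x ∈ Q.S
  · have h1 : f.inl (f.toEquiv.symm ⟨x, hx⟩ : P.carrier) = f.inr x :=
      f.inl_eq_inr.2 ⟨(f.toEquiv.symm ⟨x, hx⟩).2, by simp⟩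
    obtain ⟨_, h2⟩ := f.inl_eq_inr.1 (h1.trans h)
    rw [← h2]; simp
  · by_cases hy : y ∈ Q.S
    · simp [inr, hx, hy] at h
    · simpa [inr, hx, hy] using h

theorem cases (z : f.Carrier) : (∃ x, z = f.inl x) ∨ ∃ y, y ∉ Q.S ∧ z = f.inr y := by
  rcases z with x | ⟨y, hy⟩
  · exact Or.inl ⟨x, rfl⟩
  · exact Or.inr ⟨y, hy, by simp [inr, hy]⟩

/-- The precedence order of the gluing. -/
inductive Prec : f.Carrier → f.Carrier → Prop
  | left {x y : P.carrier} : P.prec x y → Prec (f.inl x) (f.inl y)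
  | right {x y : Q.carrier} : Q.prec x y → Prec (f.inr x) (f.inr y)
  | cross {x : P.carrier} {y : Q.carrier} : x ∉ P.T → y ∉ Q.S → Prec (f.inl x) (f.inr y)

/-- The union of the event orders of `P` and `Q`, in the gluing. -/
inductive Evt₀ : f.Carrier → f.Carrier → Prop
  | left {x y : P.carrier} : P.evt x y → Evt₀ (f.inl x) (f.inl y)
  | right {x y : Q.carrier} : Q.evt x y → Evt₀ (f.inr x) (f.inr y)

/-- The event order of the gluing. -/
def Evt : f.Carrier → f.Carrier → Prop := Relation.TransGen f.Evt₀

theorem prec_iff {a b : f.Carrier} : f.Prec a b ↔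
    (∃ x y, a = f.inl x ∧ b = f.inl y ∧ P.prec x y) ∨
    (∃ x y, a = f.inr x ∧ b = f.inr y ∧ Q.prec x y) ∨
    (∃ x y, a = f.inl x ∧ b = f.inr y ∧ x ∉ P.T ∧ y ∉ Q.S) := by
  constructor
  · rintro (h | h | ⟨h, h'⟩)
    · exact Or.inl ⟨_, _, rfl, rfl, h⟩
    · exact Or.inr (Or.inl ⟨_, _, rfl, rfl, h⟩)
    · exact Or.inr (Or.inr ⟨_, _, rfl, rfl, h, h'⟩)
  · rintro (⟨x, y, rfl, rfl, h⟩ | ⟨x, y, rfl, rfl, h⟩ | ⟨x, y, rfl, rfl, h, h'⟩)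
    · exact .left h
    · exact .right h
    · exact .cross h h'

theorem prec_irrefl (a : f.Carrier) : ¬ f.Prec a a := by
  rw [prec_iff]
  rintro (⟨x, y, rfl, hb, h⟩ | ⟨x, y, rfl, hb, h⟩ | ⟨x, y, rfl, hb, h, h'⟩)
  · rw [f.inl_injective hb] at h; exact P.prec_irrefl _ h
  · rw [f.inr_injective hb] at h; exact Q.prec_irrefl _ h
  · obtain ⟨k, -⟩ := f.inl_eq_inr.1 hb; exact h k

theorem prec_trans (a b c : f.Carrier) (hab : f.Prec a b) (hbc : f.Prec b c) : f.Prec a c := by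
  rw [prec_iff] at hab hbc
  rcases hab with ⟨x, y, rfl, rfl, h⟩ | ⟨x, y, rfl, rfl, h⟩ | ⟨x, y, rfl, rfl, h, h'⟩ <;>
  rcases hbc with ⟨x', z, e, rfl, k⟩ | ⟨x', z, e, rfl, k⟩ | ⟨x', z, e, rfl, k, k'⟩
  · rw [← f.inl_injective e] at k; exact .left (P.prec_trans _ _ _ h k)
  · exact .cross (fun hx => P.T_maximal _ hx _ h) (fun hz => Q.S_minimal _ hz _ k)
  · exact .cross (fun hx => P.T_maximal _ hx _ h) k'
  · obtain ⟨hT, rfl⟩ := f.inl_eq_inr.1 e.symm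
    exact (Q.S_minimal _ (f.toEquiv ⟨x', hT⟩).2 _ h).elim
  · rw [← f.inr_injective e] at k; exact .right (Q.prec_trans _ _ _ h k)
  · obtain ⟨hT, -⟩ := f.inl_eq_inr.1 e.symm; exact (k hT).elim
  · obtain ⟨hT, rfl⟩ := f.inl_eq_inr.1 e.symm
    exact (h' (f.toEquiv ⟨x', hT⟩).2).elim
  · exact .cross h (fun hz => Q.S_minimal _ hz _ k)
  · exact .cross h k'

theorem evt_cases {a b : f.Carrier} (h : f.Evt a b) :
    (∃ x y, a = f.inl x ∧ b = f.inl y ∧ P.evt x y) ∨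
    (∃ x y, a = f.inr x ∧ b = f.inr y ∧ Q.evt x y) ∨
    (∃ x y, ∃ t : {x // x ∈ P.T}, a = f.inl x ∧ b = f.inr y ∧ P.evt x t ∧
      Q.evt (f.toEquiv t) y) ∨
    (∃ x y, ∃ t : {x // x ∈ P.T}, a = f.inr x ∧ b = f.inl y ∧ Q.evt x (f.toEquiv t) ∧
      P.evt t y) := by
  induction h with
  | single h =>
    rcases h with h | h
    · exact Or.inl ⟨_, _, rfl, rfl, h⟩
    · exact Or.inr (Or.inl ⟨_, _, rfl, rfl, h⟩)
  | tail _ h ih =>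
    rcases ih with ⟨x, y, rfl, hb, k⟩ | ⟨x, y, rfl, hb, k⟩ | ⟨x, y, t, rfl, hb, k, l⟩ |
      ⟨x, y, t, rfl, hb, k, l⟩ <;>
    rcases h with h | h
    · rw [f.inl_injective hb] at h
      exact Or.inl ⟨_, _, rfl, rfl, P.evt_trans _ _ _ k h⟩
    · obtain ⟨hT, rfl⟩ := f.inl_eq_inr.1 hb.symm
      exact Or.inr (Or.inr (Or.inl ⟨_, _, ⟨y, hT⟩, rfl, rfl, k, h⟩))
    · obtain ⟨hT, rfl⟩ := f.inl_eq_inr.1 hb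
      exact Or.inr (Or.inr (Or.inr ⟨_, _, ⟨_, hT⟩, rfl, rfl, k, h⟩))
    · rw [f.inr_injective hb] at h
      exact Or.inr (Or.inl ⟨_, _, rfl, rfl, Q.evt_trans _ _ _ k h⟩)
    · obtain ⟨hT, rfl⟩ := f.inl_eq_inr.1 hb
      exact Or.inl ⟨_, _, rfl, rfl,
        P.evt_trans _ _ _ (P.evt_trans _ _ _ k ((f.evt_iff _ _).1 l)) h⟩
    · rw [f.inr_injective hb] at h
      exact Or.inr (Or.inr (Or.inl ⟨_, _, t, rfl, rfl, k, Q.evt_trans _ _ _ l h⟩))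
    · rw [f.inl_injective hb] at h
      exact Or.inr (Or.inr (Or.inr ⟨_, _, t, rfl, rfl, k, P.evt_trans _ _ _ l h⟩))
    · obtain ⟨hT, rfl⟩ := f.inl_eq_inr.1 hb.symm
      exact Or.inr (Or.inl ⟨_, _, rfl, rfl, Q.evt_trans _ _ _
        (Q.evt_trans _ _ _ k ((f.evt_iff t ⟨y, hT⟩).2 l)) h⟩)

theorem evt_irrefl (a : f.Carrier) : ¬ f.Evt a a := by
  intro h
  rcases f.evt_cases h with ⟨x, y, rfl, hb, k⟩ | ⟨x, y, rfl, hb, k⟩ | ⟨x, y, t, rfl, hb, k, l⟩ |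
      ⟨x, y, t, rfl, hb, k, l⟩
  · rw [f.inl_injective hb] at k; exact P.evt_irrefl _ k
  · rw [f.inr_injective hb] at k; exact Q.evt_irrefl _ k
  · obtain ⟨hT, rfl⟩ := f.inl_eq_inr.1 hb
    exact P.evt_irrefl _ (P.evt_trans _ _ _ k ((f.evt_iff t ⟨x, hT⟩).1 l))
  · obtain ⟨hT, rfl⟩ := f.inl_eq_inr.1 hb.symm
    exact P.evt_irrefl _ (P.evt_trans _ _ _ ((f.evt_iff ⟨y, hT⟩ t).1 k) l)

theorem evt_inl_iff {x y : P.carrier} : f.Evt (f.inl x) (f.inl y) ↔ P.evt x y := by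
  refine ⟨fun h => ?_, fun h => .single (.left h)⟩
  rcases f.evt_cases h with ⟨x', y', ha, hb, k⟩ | ⟨x', y', ha, hb, k⟩ |
    ⟨x', y', t, ha, hb, k, l⟩ | ⟨x', y', t, ha, hb, k, l⟩
  · rwa [f.inl_injective ha, f.inl_injective hb]
  · obtain ⟨h1, rfl⟩ := f.inl_eq_inr.1 ha
    obtain ⟨h2, rfl⟩ := f.inl_eq_inr.1 hb
    exact (f.evt_iff _ _).1 k
  · obtain ⟨h2, rfl⟩ := f.inl_eq_inr.1 hb
    rw [f.inl_injective ha]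
    exact P.evt_trans _ _ _ k ((f.evt_iff t ⟨y, h2⟩).1 l)
  · obtain ⟨h1, rfl⟩ := f.inl_eq_inr.1 ha
    rw [f.inl_injective hb]
    exact P.evt_trans _ _ _ ((f.evt_iff ⟨x, h1⟩ t).1 k) l

theorem evt_inr_iff {x y : Q.carrier} : f.Evt (f.inr x) (f.inr y) ↔ Q.evt x y := by
  refine ⟨fun h => ?_, fun h => .single (.right h)⟩
  rcases f.evt_cases h with ⟨x', y', ha, hb, k⟩ | ⟨x', y', ha, hb, k⟩ |
    ⟨x', y', t, ha, hb, k, l⟩ | ⟨x', y', t, ha, hb, k, l⟩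
  · obtain ⟨h1, rfl⟩ := f.inl_eq_inr.1 ha.symm
    obtain ⟨h2, rfl⟩ := f.inl_eq_inr.1 hb.symm
    exact (f.evt_iff ⟨x', h1⟩ ⟨y', h2⟩).2 k
  · rwa [f.inr_injective ha, f.inr_injective hb]
  · obtain ⟨h1, rfl⟩ := f.inl_eq_inr.1 ha.symm
    rw [f.inr_injective hb]
    exact Q.evt_trans _ _ _ ((f.evt_iff ⟨x', h1⟩ t).2 k) l
  · obtain ⟨h2, rfl⟩ := f.inl_eq_inr.1 hb.symm
    rw [f.inr_injective ha]
    exact Q.evt_trans _ _ _ k ((f.evt_iff t ⟨y', h2⟩).2 l)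

/-- The labelling of the gluing. -/
def lab : f.Carrier → Act := Sum.elim P.lab fun y => Q.lab y

theorem lab_inr (y : Q.carrier) : f.lab (f.inr y) = Q.lab y := by
  unfold lab inr
  split_ifs with h
  · simp [← f.lab_eq]
  · rfl

end InterfaceIso

/-- The gluing composition `P * Q` along the isomorphism `f : T_P ≃ S_Q`. -/
noncomputable def glue (P Q : Iposet Act) (f : InterfaceIso P Q) : Iposet Act where
  carrier := f.Carrier
  finite := by
    have := P.finite
    have := Q.finite
    exact inferInstanceAs (Finite (P.carrier ⊕ {y : Q.carrier // y ∉ Q.S}))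
  prec := f.Prec
  evt := f.Evt
  S := f.inl '' P.S
  T := f.inr '' Q.T
  lab := f.lab
  prec_irrefl := f.prec_irrefl
  prec_trans := f.prec_trans
  evt_irrefl := f.evt_irrefl
  evt_trans _ _ _ := Relation.TransGen.trans
  comparable a b := by
    have hPP : ∀ x y, f.inl x = f.inl y ∨ f.Prec (f.inl x) (f.inl y) ∨
        f.Prec (f.inl y) (f.inl x) ∨ f.Evt (f.inl x) (f.inl y) ∨ f.Evt (f.inl y) (f.inl x) := by
      intro x y
      rcases P.comparable x y with h | h | h | h | h
      · exact Or.inl (congrArg _ h)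
      · exact Or.inr (Or.inl (.left h))
      · exact Or.inr (Or.inr (Or.inl (.left h)))
      · exact Or.inr (Or.inr (Or.inr (Or.inl (.single (.left h)))))
      · exact Or.inr (Or.inr (Or.inr (Or.inr (.single (.left h)))))
    have hQQ : ∀ x y, f.inr x = f.inr y ∨ f.Prec (f.inr x) (f.inr y) ∨
        f.Prec (f.inr y) (f.inr x) ∨ f.Evt (f.inr x) (f.inr y) ∨ f.Evt (f.inr y) (f.inr x) := by
      intro x y
      rcases Q.comparable x y with h | h | h | h | h
      · exact Or.inl (congrArg _ h)
      · exact Or.inr (Or.inl (.right h))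
      · exact Or.inr (Or.inr (Or.inl (.right h)))
      · exact Or.inr (Or.inr (Or.inr (Or.inl (.single (.right h)))))
      · exact Or.inr (Or.inr (Or.inr (Or.inr (.single (.right h)))))
    rcases f.cases a with ⟨x, rfl⟩ | ⟨x, hx, rfl⟩ <;>
    rcases f.cases b with ⟨y, rfl⟩ | ⟨y, hy, rfl⟩
    · exact hPP x y
    · by_cases hT : x ∈ P.T
      · rw [f.inl_eq_inr.2 ⟨hT, rfl⟩]; exact hQQ _ _
      · exact Or.inr (Or.inl (.cross hT hy))
    · by_cases hT : y ∈ P.T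
      · rw [f.inl_eq_inr.2 ⟨hT, rfl⟩]; exact hQQ _ _
      · exact Or.inr (Or.inr (Or.inl (.cross hT hx)))
    · exact hQQ x y
  S_minimal := by
    rintro _ ⟨x, hx, rfl⟩ b h
    rw [f.prec_iff] at h
    rcases h with ⟨x', y, rfl, hb, h⟩ | ⟨x', y, rfl, hb, h⟩ | ⟨x', y, rfl, hb, h, h'⟩
    · rw [← f.inl_injective hb] at h; exact P.S_minimal _ hx _ h
    · obtain ⟨hT, rfl⟩ := f.inl_eq_inr.1 hb
      exact Q.S_minimal _ (f.toEquiv ⟨x, hT⟩).2 _ h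
    · obtain ⟨hT, rfl⟩ := f.inl_eq_inr.1 hb
      exact h' (f.toEquiv ⟨x, hT⟩).2
  T_maximal := by
    rintro _ ⟨x, hx, rfl⟩ b h
    rw [f.prec_iff] at h
    rcases h with ⟨x', y, hb, rfl, h⟩ | ⟨x', y, hb, rfl, h⟩ | ⟨x', y, hb, rfl, h, h'⟩
    · obtain ⟨hT, -⟩ := f.inl_eq_inr.1 hb.symm
      exact P.T_maximal _ hT _ h
    · rw [← f.inr_injective hb] at h; exact Q.T_maximal _ hx _ h
    · obtain ⟨hT, -⟩ := f.inl_eq_inr.1 hb.symm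
      exact h hT

/-- The discrete iposet `_S U_T` on a word `U`; its event order is the order of `U`. -/
def discrete (U : LoWord Act) (S T : Set (Fin U.n)) : Iposet Act where
  carrier := Fin U.n
  finite := inferInstance
  prec _ _ := False
  evt i j := i < j
  S := S
  T := T
  lab := U.lab
  prec_irrefl _ h := h
  prec_trans _ _ _ h _ := h
  evt_irrefl := lt_irrefl
  evt_trans _ _ _ := lt_trans
  comparable i j := by
    rcases lt_trichotomy i j with h | h | h <;> simp [h]
  S_minimal _ _ _ h := h
  T_maximal _ _ _ h := h

/-- `e` is an isomorphism from the lo-set `U` to the subset `I` of `P`. -/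
structure IsLoIso (P : Iposet Act) (I : Set P.carrier) (U : LoWord Act)
    (e : Fin U.n ≃ {x // x ∈ I}) : Prop where
  evt_iff : ∀ i j, P.evt (e i) (e j) ↔ i < j
  lab_eq : ∀ i, P.lab (e i) = U.lab i

/-- An iposet whose source and target interfaces are identified with `U` and `V`. -/
structure Between (U V : LoWord Act) where
  P : Iposet Act
  src : Fin U.n ≃ {x // x ∈ P.S}
  tgt : Fin V.n ≃ {x // x ∈ P.T}
  src_iso : IsLoIso P P.S U src
  tgt_iso : IsLoIso P P.T V tgt

namespace Between

variable {U V W : LoWord Act}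

/-- The isomorphism from the target interface of `P` to the source interface of `Q`. -/
def interfaceIso (P : Between U V) (Q : Between V W) : InterfaceIso P.P Q.P where
  toEquiv := P.tgt.symm.trans Q.src
  evt_iff x y := by
    rw [Equiv.trans_apply, Equiv.trans_apply, Q.src_iso.evt_iff, ← P.tgt_iso.evt_iff]
    simp
  lab_eq x := by
    rw [Equiv.trans_apply, Q.src_iso.lab_eq, ← P.tgt_iso.lab_eq]
    simp

/-- Gluing, with the interfaces of the result identified in the evident way. -/
noncomputable def glue (P : Between U V) (Q : Between V W) : Between U W where
  P := Iposet.glue P.P Q.P (P.interfaceIso Q)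
  src := P.src.trans (Equiv.Set.image _ P.P.S (P.interfaceIso Q).inl_injective)
  tgt := Q.tgt.trans (Equiv.Set.image _ Q.P.T (P.interfaceIso Q).inr_injective)
  src_iso :=
    { evt_iff := fun i j => (P.interfaceIso Q).evt_inl_iff.trans (P.src_iso.evt_iff i j)
      lab_eq := fun i => P.src_iso.lab_eq i }
  tgt_iso :=
    { evt_iff := fun i j => (P.interfaceIso Q).evt_inr_iff.trans (Q.tgt_iso.evt_iff i j)
      lab_eq := fun i => ((P.interfaceIso Q).lab_inr _).trans (Q.tgt_iso.lab_eq i) }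

/-- The identity iposet `_U U_U`. -/
def id (U : LoWord Act) : Between U U where
  P := discrete U Set.univ Set.univ
  src := (Equiv.Set.univ _).symm
  tgt := (Equiv.Set.univ _).symm
  src_iso := ⟨fun _ _ => Iff.rfl, fun _ => rfl⟩
  tgt_iso := ⟨fun _ _ => Iff.rfl, fun _ => rfl⟩

/-- The iposet `_{V ∖ A} V_V` of an up-step `d⁰_A : U → V`. -/
noncomputable def up (d : Coface U V) (h : d.B = ∅) : Between U V where
  P := discrete V d.Aᶜ Set.univ
  src := (Equiv.ofInjective _ d.emb.injective).trans
    (Equiv.setCongr (by rw [d.range_emb, h, Set.union_empty]; rfl))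
  tgt := (Equiv.Set.univ _).symm
  src_iso := ⟨fun _ _ => d.emb.lt_iff_lt, d.lab_emb⟩
  tgt_iso := ⟨fun _ _ => Iff.rfl, fun _ => rfl⟩

/-- The iposet `_V V_{V ∖ B}` of a down-step `d¹_B : U → V`. -/
noncomputable def down (d : Coface U V) (h : d.A = ∅) : Between V U where
  P := discrete V Set.univ d.Bᶜ
  src := (Equiv.Set.univ _).symm
  tgt := (Equiv.ofInjective _ d.emb.injective).trans
    (Equiv.setCongr (by rw [d.range_emb, h, Set.empty_union]; rfl))
  src_iso := ⟨fun _ _ => Iff.rfl, fun _ => rfl⟩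
  tgt_iso := ⟨fun _ _ => d.emb.lt_iff_lt, d.lab_emb⟩

end Between

end Iposet

/-! ### Paths and languages -/

section Paths

variable {Act : Type v} {C : Type v} [Category.{0} C]

/-- Steps between cells of a presheaf `X` on a category `C` over `□`, where `F` gives the
underlying words and coface maps: `C = □` with the identity functor for precubical sets, `C = I□`
with the forgetful functor for precubical sets with interfaces.
* `up`: a step along `φ = d⁰_A : U → V` from `x = δ⁰_A(y)` in `X[U]` to `y` in `X[V]`;
* `down`: a step along `φ = d¹_B : V → U` from `x` in `X[U]` to `y = δ¹_B(x)` in `X[V]`. -/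
inductive Step (F : C ⥤ LoWord Act) (X : Cᵒᵖ ⥤ Type w) : Cell X → Cell X → Type (max v w)
  | up {x y : Cell X} (φ : x.1 ⟶ y.1) (hB : Coface.B (F.map φ) = ∅)
      (h : X.map φ.op y.2 = x.2) : Step F X x y
  | down {x y : Cell X} (φ : y.1 ⟶ x.1) (hA : Coface.A (F.map φ) = ∅)
      (h : X.map φ.op x.2 = y.2) : Step F X x y

/-- Paths from a cell to a cell: finite composable sequences of steps. -/
inductive HPath (F : C ⥤ LoWord Act) (X : Cᵒᵖ ⥤ Type w) : Cell X → Cell X → Type (max v w)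
  | nil (x : Cell X) : HPath F X x x
  | snoc {x y z : Cell X} (p : HPath F X x y) (s : Step F X y z) : HPath F X x z

variable {F : C ⥤ LoWord Act} {X : Cᵒᵖ ⥤ Type w}

/-- The iposet of a step. -/
noncomputable def Step.ev {x y : Cell X} :
    Step F X x y → Iposet.Between (F.obj x.1) (F.obj y.1)
  | .up φ hB _ => Iposet.Between.up (F.map φ) hB
  | .down φ hA _ => Iposet.Between.down (F.map φ) hA

/-- The event iposet of a path: the gluing of the iposets of its steps. -/
noncomputable def HPath.ev :
    {x y : Cell X} → HPath F X x y → Iposet.Between (F.obj x.1) (F.obj y.1)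
  | _, _, .nil x => Iposet.Between.id (F.obj x.1)
  | _, _, .snoc p s => p.ev.glue s.ev

end Paths

/-- The ipomsets of the accepting paths of an HDA. -/
def HDA.Lang {Act : Type v} (H : HDA.{v, w} Act) : Set (Ipomset Act) :=
  {P | ∃ x ∈ H.start, ∃ y ∈ H.accept, ∃ p : HPath (𝟭 (LoWord Act)) H.X x y,
    Ipomset.mk p.ev.P = P}

/-- The ipomsets of the accepting paths of an iHDA. -/
def IHDA.Lang {Act : Type v} (H : IHDA.{v, w} Act) : Set (Ipomset Act) :=
  {P | ∃ x ∈ H.start, ∃ y ∈ H.accept, ∃ p : HPath (IloWord.forget Act) H.X x y,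
    Ipomset.mk p.ev.P = P}

/-! A path records when its events live. Number its cells `0, ..., n`: each event is present exactly
in the cells from a birth time `b e` to a death time `t e`; the source interface consists of the
events with `b e = 0`, the target interface of those with `n ≤ t e`, and `e` precedes `e'` iff `t e
< b e'`. So event ipomsets of paths are interval ipomsets. A path can be exchanged for a `Run`, a
sequence of cells marked by the events alive at each time, and back (`HPath.exists_run`,
`Run.exists_path`).

For down-closure, let `P ⊑ Q` with `Q` the ipomset of a path, and represent `P` by new integer times
`b'`, `t'` such that no step has both births and deaths. Let `κ k` be the largest old birth time of
an event with `b' e ≤ k` (and `n` at the final time). If `b' e' ≤ k ≤ t' e`, then `e` does not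
precede `e'` in `P`, hence not in `Q`, so `b e' ≤ t e`. Thus all events that should be alive at the
new time `k` are alive in the old cell at time `κ k`. The new cell is the face of that cell in which
the events with `k < b' e` are unstarted and those with `t' e < k` are done. Consecutive new cells
are faces of a common cell, hence joined by an up-step or a down-step, and the end cells do not
change (`Run.refine`).

With interfaces, faces may not unstart events in the source interface of a cell or terminate events
in its target interface. Events of the former kind are born at time `0` and events of the latter
live to the end, so the required faces exist (`Run.birth_eq_zero`, `Run.le_death`). `FaceSystem`
isolates what the argument needs, so that `□` and `I□` are treated together. -/

/-! ### Faces in the precube categories -/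

namespace Coface

variable {Act : Type v} {U V W : LoWord Act}

theorem mem_comp_A (d : Coface U V) (e : Coface V W) (j : Fin V.n) :
    e.emb j ∈ (d.comp e).A ↔ j ∈ d.A := by
  simp [comp, e.emb_notMem_A]

theorem mem_comp_B (d : Coface U V) (e : Coface V W) (j : Fin V.n) :
    e.emb j ∈ (d.comp e).B ↔ j ∈ d.B := by
  simp [comp, e.emb_notMem_B]

/-- Every pair of disjoint sets of events determines a face. -/
theorem exists_of_disjoint (V : LoWord Act) (A B : Set (Fin V.n)) (h : Disjoint A B) :
    ∃ (U : LoWord Act) (d : Coface U V), d.A = A ∧ d.B = B := by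
  classical
  let s : Finset (Fin V.n) := (A ∪ B)ᶜ.toFinset
  exact ⟨⟨s.card, fun i => V.lab (s.orderEmbOfFin rfl i)⟩,
    { emb := s.orderEmbOfFin rfl
      lab_emb := fun _ => rfl
      A := A
      B := B
      disj := h
      range_emb := by rw [Finset.range_orderEmbOfFin]; simp [s] }, rfl, rfl⟩

/-- A face with more unstarted and more terminated events factors through the larger face. -/
theorem exists_comp_eq (d : Coface V W) (e : Coface U W) (hA : d.A ⊆ e.A) (hB : d.B ⊆ e.B) :
    ∃ f : Coface U V, f.comp d = e := by
  -- The events kept by `e` avoid `e.A ∪ e.B`, hence also `d.A ∪ d.B`, so they are kept by `d`.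
  have hex : ∀ i, ∃ j, d.emb j = e.emb i := fun i =>
    d.exists_emb _ (fun h => e.emb_notMem_A i (hA h)) (fun h => e.emb_notMem_B i (hB h))
  choose k hk using hex
  have hA' : d.emb '' (d.emb ⁻¹' e.A) ∪ d.A = e.A := by
    ext j
    constructor
    · rintro (⟨i, hi, rfl⟩ | hj)
      · exact hi
      · exact hA hj
    · intro hj
      by_cases hjA : j ∈ d.A
      · exact Or.inr hjA
      · obtain ⟨i, rfl⟩ := d.exists_emb j hjA
          (fun h => Set.disjoint_left.1 e.disj hj (hB h))
        exact Or.inl ⟨i, hj, rfl⟩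
  have hB' : d.emb '' (d.emb ⁻¹' e.B) ∪ d.B = e.B := by
    ext j
    constructor
    · rintro (⟨i, hi, rfl⟩ | hj)
      · exact hi
      · exact hB hj
    · intro hj
      by_cases hjB : j ∈ d.B
      · exact Or.inr hjB
      · obtain ⟨i, rfl⟩ := d.exists_emb j
          (fun h => Set.disjoint_left.1 e.disj (hA h) hj) hjB
        exact Or.inl ⟨i, hj, rfl⟩
  refine ⟨
    { emb := OrderEmbedding.ofMapLEIff k fun i j => by
        rw [← d.emb.le_iff_le, hk, hk, e.emb.le_iff_le]
      lab_emb := fun i => by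
        rw [← e.lab_emb, ← hk, d.lab_emb]; rfl
      A := d.emb ⁻¹' e.A
      B := d.emb ⁻¹' e.B
      disj := e.disj.preimage _
      range_emb := ?_ }, ?_⟩
  · ext j
    constructor
    · rintro ⟨i, rfl⟩ (h | h)
      · exact e.emb_notMem_A i (by simpa [hk] using h)
      · exact e.emb_notMem_B i (by simpa [hk] using h)
    · intro hj
      obtain ⟨i, hi⟩ := e.exists_emb (d.emb j) (fun h => hj (Or.inl h)) (fun h => hj (Or.inr h))
      exact ⟨i, d.emb.injective ((hk i).trans hi)⟩
  · refine Coface.ext ?_ hA' hB'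
    ext i
    exact congrArg Fin.val (hk i)

end Coface

/-- The properties of a category over `□` that make faces of its objects available: every object
has sets `S` and `T` of events that cannot be unstarted resp. terminated, all other faces exist,
and faces factor through larger faces. -/
structure FaceSystem {Act : Type v} {C : Type v} [Category.{0} C] (F : C ⥤ LoWord Act) where
  S : ∀ c, Set (Fin (F.obj c).n)
  T : ∀ c, Set (Fin (F.obj c).n)
  emb_mem_S : ∀ {c d : C} (φ : c ⟶ d) i, Coface.emb (F.map φ) i ∈ S d ↔ i ∈ S c
  emb_mem_T : ∀ {c d : C} (φ : c ⟶ d) i, Coface.emb (F.map φ) i ∈ T d ↔ i ∈ T c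
  disj_S : ∀ {c d : C} (φ : c ⟶ d), Disjoint (Coface.A (F.map φ)) (S d)
  disj_T : ∀ {c d : C} (φ : c ⟶ d), Disjoint (Coface.B (F.map φ)) (T d)
  exists_face : ∀ (d : C) (A B : Set (Fin (F.obj d).n)), Disjoint A B → Disjoint A (S d) →
    Disjoint B (T d) → ∃ (c : C) (φ : c ⟶ d), Coface.A (F.map φ) = A ∧ Coface.B (F.map φ) = B
  factor : ∀ {c d e : C} (φ : d ⟶ e) (ψ : c ⟶ e), Coface.A (F.map φ) ⊆ Coface.A (F.map ψ) →
    Coface.B (F.map φ) ⊆ Coface.B (F.map ψ) → ∃ θ : c ⟶ d, θ ≫ φ = ψ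

/-- The faces of `□`. -/
def LoWord.faceSystem (Act : Type v) : FaceSystem (𝟭 (LoWord Act)) where
  S _ := ∅
  T _ := ∅
  emb_mem_S _ _ := Iff.rfl
  emb_mem_T _ _ := Iff.rfl
  disj_S _ := disjoint_bot_right
  disj_T _ := disjoint_bot_right
  exists_face d A B h _ _ := Coface.exists_of_disjoint d A B h
  factor φ ψ hA hB := Coface.exists_comp_eq φ ψ hA hB

/-- The faces of `I□`. -/
def IloWord.faceSystem (Act : Type v) : FaceSystem (IloWord.forget Act) where
  S c := c.S
  T c := c.T
  emb_mem_S φ i := by rw [ICoface.preimage_S φ]; rfl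
  emb_mem_T φ i := by rw [ICoface.preimage_T φ]; rfl
  disj_S φ := ICoface.disj_S φ
  disj_T φ := ICoface.disj_T φ
  exists_face d A B h hS hT := by
    obtain ⟨U, e, rfl, rfl⟩ := Coface.exists_of_disjoint d.lo A B h
    -- The interfaces of a face are forced to be the restrictions of those of `d`.
    exact ⟨⟨U, e.emb ⁻¹' d.S, e.emb ⁻¹' d.T⟩, ⟨e, rfl, rfl, hS, hT⟩, rfl, rfl⟩
  factor {c d e} φ ψ hA hB := by
    obtain ⟨f, hf⟩ := Coface.exists_comp_eq (ICoface.base φ) (ICoface.base ψ) hA hB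
    have hk : ∀ i, (ICoface.base φ).emb (f.emb i) = (ICoface.base ψ).emb i := fun i => by
      rw [← hf]; rfl
    refine ⟨⟨f, ?_, ?_, ?_, ?_⟩, ICoface.ext hf⟩
    · ext i
      rw [ICoface.preimage_S φ, ICoface.preimage_S ψ, Set.mem_preimage, Set.mem_preimage,
        Set.mem_preimage, hk]
    · ext i
      rw [ICoface.preimage_T φ, ICoface.preimage_T ψ, Set.mem_preimage, Set.mem_preimage,
        Set.mem_preimage, hk]
    · rw [Set.disjoint_left]
      intro i hi hS
      rw [ICoface.preimage_S φ] at hS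
      refine Set.disjoint_left.1 (ICoface.disj_S ψ) ?_ hS
      rw [← hf]
      exact (f.mem_comp_A _ i).2 hi
    · rw [Set.disjoint_left]
      intro i hi hT
      rw [ICoface.preimage_T φ] at hT
      refine Set.disjoint_left.1 (ICoface.disj_T ψ) ?_ hT
      rw [← hf]
      exact (f.mem_comp_B _ i).2 hi

/-! ### Realizing an iposet by birth and death times -/

section Realizes

variable {Act : Type v} {E : Type}

/-- The iposet `P`, embedded by `g` in the set `E` of events with birth times `b` and death times
`t`, consists of the events born up to time `n`, with the precedence order and the interfaces
determined by these times. -/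
structure Realizes (evt : E → E → Prop) (lab : E → Act) (b t : E → ℕ) (n : ℕ) (P : Iposet Act)
    (g : P.carrier → E) : Prop where
  injective : Function.Injective g
  exists_iff : ∀ e, (∃ x, g x = e) ↔ b e ≤ n
  mem_S : ∀ x, x ∈ P.S ↔ b (g x) = 0
  mem_T : ∀ x, x ∈ P.T ↔ n ≤ t (g x)
  prec_iff : ∀ x y, P.prec x y ↔ t (g x) < b (g y)
  evt : ∀ x y, P.evt x y → ¬ P.prec x y → ¬ P.prec y x → evt (g x) (g y)
  lab : ∀ x, lab (g x) = P.lab x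

variable {evt : E → E → Prop} {lab : E → Act} {b t b' t' : E → ℕ} {n : ℕ} {P R : Iposet Act}

/-- Death times enter only through comparison with `n` and with birth times, which are at most `n`;
so values from `n` upwards are interchangeable. This allows the times to be updated when a path is
extended. -/
theorem Realizes.congr {g : P.carrier → E} (h : Realizes evt lab b t n P g)
    (hn : ∀ e, b' e ≤ n ↔ b e ≤ n) (hb : ∀ x, b' (g x) = b (g x))
    (ht : ∀ x, ∀ k ≤ n, k ≤ t' (g x) ↔ k ≤ t (g x)) : Realizes evt lab b' t' n P g where
  injective := h.injective
  exists_iff e := (h.exists_iff e).trans (hn e).symm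
  mem_S x := by rw [hb]; exact h.mem_S x
  mem_T x := by rw [ht x n le_rfl]; exact h.mem_T x
  prec_iff x y := by
    rw [hb, h.prec_iff, ← not_le, ← not_le, ht x _ ((h.exists_iff _).1 ⟨y, rfl⟩)]
  evt := h.evt
  lab := h.lab

/-- Gluing a discrete iposet `R` in which all events start before or all events end after. -/
theorem Realizes.glue (f : Iposet.InterfaceIso P R) (g : f.Carrier → E)
    (hP : Realizes evt lab b t n P fun x => g (f.inl x))
    (hinj : Function.Injective fun y => g (f.inr y))
    (hprec : ∀ x y, ¬ R.prec x y) (hST : (∀ y, y ∈ R.S) ∨ ∀ y, y ∈ R.T)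
    (hS : ∀ y, y ∈ R.S ↔ b (g (f.inr y)) ≤ n) (hb : ∀ y, b (g (f.inr y)) ≤ n + 1)
    (hT : ∀ y, y ∈ R.T ↔ n + 1 ≤ t (g (f.inr y)))
    (hnew : ∀ e, b e = n + 1 → ∃ y, g (f.inr y) = e)
    (hevt : ∀ x y, R.evt x y → evt (g (f.inr x)) (g (f.inr y)))
    (hlab : ∀ y, lab (g (f.inr y)) = R.lab y) :
    Realizes evt lab b t (n + 1) (Iposet.glue P R f) g := by
  have hbP : ∀ x, b (g (f.inl x)) ≤ n := fun x => (hP.exists_iff _).1 ⟨x, rfl⟩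
  have hbR : ∀ y, y ∉ R.S → b (g (f.inr y)) = n + 1 := fun y hy => by
    have := hb y; have := mt (hS y).2 hy; omega
  have htR : ∀ y, y ∉ R.S → n + 1 ≤ t (g (f.inr y)) := fun y hy =>
    (hT y).1 ((hST.resolve_left fun h => hy (h y)) y)
  have hinr : ∀ x (hx : x ∈ P.T), f.inl x = f.inr (f.toEquiv ⟨x, hx⟩) := fun x hx =>
    f.inl_eq_inr.2 ⟨hx, rfl⟩
  have hinl : ∀ y, y ∈ R.S → ∃ x, x ∈ P.T ∧ f.inl x = f.inr y := fun y hy =>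
    ⟨_, (f.toEquiv.symm ⟨y, hy⟩).2, f.inl_eq_inr.2 ⟨(f.toEquiv.symm ⟨y, hy⟩).2, by simp⟩⟩
  have hprec' : ∀ a c, f.Prec a c ↔ t (g a) < b (g c) := by
    intro a c
    constructor
    · rintro (h | h | ⟨hx, hy⟩)
      · exact (hP.prec_iff _ _).1 h
      · exact (hprec _ _ h).elim
      · have := mt (hP.mem_T _).2 hx
        rw [hbR _ hy]; omega
    · intro h
      rcases f.cases a with ⟨x, rfl⟩ | ⟨x, hx, rfl⟩ <;>
      rcases f.cases c with ⟨y, rfl⟩ | ⟨y, hy, rfl⟩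
      · exact .left ((hP.prec_iff _ _).2 h)
      -- The times alone give only `t x < n + 1`. If `x` were in `P.T`, it would take part in the
      -- step in which `y` is born; that step terminates nothing, so `n + 1 ≤ t x`.
      · refine .cross (fun hx => ?_) hy
        rw [hinr x hx, hbR y hy] at h
        have := (hT (f.toEquiv ⟨x, hx⟩)).1 ((hST.resolve_left fun h => hy (h y)) _)
        omega
      · have := htR x hx; have := hbP y; omega
      · have := htR x hx; have := hb y; omega
  refine ⟨?_, fun e => ⟨?_, fun he => ?_⟩, fun a => ⟨?_, fun ha => ?_⟩, fun a => ⟨?_, fun ha => ?_⟩,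
    hprec', fun a c h h1 h2 => ?_, fun a => ?_⟩
  · intro a c h
    rcases f.cases a with ⟨x, rfl⟩ | ⟨x, hx, rfl⟩ <;>
    rcases f.cases c with ⟨y, rfl⟩ | ⟨y, hy, rfl⟩
    · exact congrArg _ (hP.injective h)
    · have := hbP x; have := hbR y hy; rw [← h] at this; omega
    · have := hbP y; have := hbR x hx; rw [h] at this; omega
    · exact congrArg _ (hinj h)
  · rintro ⟨a, rfl⟩
    rcases f.cases a with ⟨x, rfl⟩ | ⟨x, hx, rfl⟩
    · exact (hbP x).trans n.le_succ
    · exact hb x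
  · rcases Nat.of_le_succ he with he | he
    · obtain ⟨x, hx⟩ := (hP.exists_iff e).2 he
      exact ⟨_, hx⟩
    · obtain ⟨y, hy⟩ := hnew e he
      exact ⟨_, hy⟩
  · rintro ⟨x, hx, rfl⟩
    exact (hP.mem_S x).1 hx
  · rcases f.cases a with ⟨x, rfl⟩ | ⟨x, hx, rfl⟩
    · exact ⟨x, (hP.mem_S x).2 ha, rfl⟩
    · have := hbR x hx; omega
  · rintro ⟨x, hx, rfl⟩
    exact (hT x).1 hx
  · rcases f.cases a with ⟨x, rfl⟩ | ⟨x, hx, rfl⟩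
    · have hx : x ∈ P.T := (hP.mem_T x).2 (n.le_succ.trans ha)
      rw [hinr x hx] at ha
      exact ⟨_, (hT _).2 ha, (hinr x hx).symm⟩
    · exact ⟨x, (hT x).2 ha, rfl⟩
  -- The transitive closure adds nothing inside `P` or inside `R`, and elements outside `P.T`
  -- precede those outside `R.S`. So two concurrent elements lie together in `P` or together in `R`.
  · have hl : ∀ x y, f.Evt (f.inl x) (f.inl y) → ¬ f.Prec (f.inl x) (f.inl y) →
        ¬ f.Prec (f.inl y) (f.inl x) → evt (g (f.inl x)) (g (f.inl y)) := fun x y h h1 h2 =>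
      hP.evt x y (f.evt_inl_iff.1 h) (fun k => h1 (.left k)) (fun k => h2 (.left k))
    have hr : ∀ x y, f.Evt (f.inr x) (f.inr y) → evt (g (f.inr x)) (g (f.inr y)) := fun x y h =>
      hevt x y (f.evt_inr_iff.1 h)
    rcases f.cases a with ⟨x, rfl⟩ | ⟨x, hx, rfl⟩ <;>
    rcases f.cases c with ⟨y, rfl⟩ | ⟨y, hy, rfl⟩
    · exact hl x y h h1 h2
    · by_cases hx : x ∈ P.T
      · rw [hinr x hx] at h ⊢; exact hr _ _ h
      · exact (h1 (.cross hx hy)).elim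
    · by_cases hy : y ∈ P.T
      · rw [hinr y hy] at h ⊢; exact hr _ _ h
      · exact (h2 (.cross hy hx)).elim
    · exact hr x y h
  · rcases f.cases a with ⟨x, rfl⟩ | ⟨x, hx, rfl⟩
    · exact hP.lab x
    · exact (hlab x).trans (f.lab_inr x).symm

end Realizes

/-! ### Runs -/

section Runs

variable {Act : Type v} {C : Type v} [Category.{0} C]

/-- A cell whose events are marked by elements of `E`. -/
structure MarkedCell (F : C ⥤ LoWord Act) (X : Cᵒᵖ ⥤ Type w) (E : Type) where
  cell : Cell X
  mark : Fin (F.obj cell.1).n → E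

/-- Steps between marked cells that are compatible with the marks. -/
inductive MarkedStep {F : C ⥤ LoWord Act} {X : Cᵒᵖ ⥤ Type w} {E : Type}
    (c d : MarkedCell F X E) : Prop
  | up (φ : c.cell.1 ⟶ d.cell.1) (hB : Coface.B (F.map φ) = ∅)
      (h : X.map φ.op d.cell.2 = c.cell.2)
      (hm : ∀ i, d.mark (Coface.emb (F.map φ) i) = c.mark i)
  | down (φ : d.cell.1 ⟶ c.cell.1) (hA : Coface.A (F.map φ) = ∅)
      (h : X.map φ.op c.cell.2 = d.cell.2)
      (hm : ∀ i, c.mark (Coface.emb (F.map φ) i) = d.mark i)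

/-- A sequence of steps between marked cells, in which the events of the `k`-th cell are the
events that are alive at time `k` according to the birth times `b` and death times `t`. -/
structure Run {F : C ⥤ LoWord Act} {X : Cᵒᵖ ⥤ Type w} {E : Type} (evt : E → E → Prop)
    (lab : E → Act) (b t : E → ℕ) (n : ℕ) (c : ℕ → MarkedCell F X E) : Prop where
  step : ∀ k < n, MarkedStep (c k) (c (k + 1))
  injective : ∀ k ≤ n, Function.Injective (c k).mark
  exists_iff : ∀ k ≤ n, ∀ e, (∃ i, (c k).mark i = e) ↔ b e ≤ k ∧ k ≤ t e
  evt : ∀ k ≤ n, ∀ i j, i < j → evt ((c k).mark i) ((c k).mark j)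
  lab : ∀ k ≤ n, ∀ i, lab ((c k).mark i) = (F.obj (c k).cell.1).lab i

variable {F : C ⥤ LoWord Act} {X : Cᵒᵖ ⥤ Type w} {E : Type}

/-! ### Steps, marked steps, and the passage between paths and runs. -/

namespace Iposet.Between

variable {U V W : LoWord Act}

theorem exists_src (P : Between U V) {y : P.P.carrier} (hy : y ∈ P.P.S) :
    ∃ i, (P.src i : P.P.carrier) = y :=
  ⟨P.src.symm ⟨y, hy⟩, by simp⟩

theorem exists_tgt (P : Between U V) {y : P.P.carrier} (hy : y ∈ P.P.T) :
    ∃ i, (P.tgt i : P.P.carrier) = y :=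
  ⟨P.tgt.symm ⟨y, hy⟩, by simp⟩

theorem inl_tgt (P : Between U V) (R : Between V W) (i : Fin V.n) :
    (P.interfaceIso R).inl (P.tgt i) = (P.interfaceIso R).inr (R.src i) :=
  (P.interfaceIso R).inl_eq_inr.2 ⟨(P.tgt i).2, by simp [interfaceIso]⟩

end Iposet.Between

theorem Step.not_prec {x y : Cell X} (s : Step F X x y) (u v : s.ev.P.carrier) :
    ¬ s.ev.P.prec u v := by
  cases s <;> exact id

/-- No single step both starts and terminates events; `Realizes.glue` rests on this. -/
theorem Step.S_or_T {x y : Cell X} (s : Step F X x y) :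
    (∀ u, u ∈ s.ev.P.S) ∨ ∀ u, u ∈ s.ev.P.T := by
  cases s
  · exact Or.inr Set.mem_univ
  · exact Or.inl Set.mem_univ

theorem Step.markedStep {x y : Cell X} (s : Step F X x y) (h : s.ev.P.carrier → E) :
    MarkedStep (F := F) (X := X) ⟨x, fun i => h (s.ev.src i)⟩ ⟨y, fun i => h (s.ev.tgt i)⟩ := by
  cases s with
  | up φ hB hx => exact .up φ hB hx fun _ => rfl
  | down φ hA hx => exact .down φ hA hx fun _ => rfl

theorem MarkedStep.exists_step {c d : MarkedCell F X E} (h : MarkedStep c d) :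
    ∃ (s : Step F X c.cell d.cell) (h : s.ev.P.carrier → E),
      (∀ i, h (s.ev.src i) = c.mark i) ∧ ∀ i, h (s.ev.tgt i) = d.mark i := by
  cases h with
  | up φ hB hx hm => exact ⟨.up φ hB hx, d.mark, hm, fun _ => rfl⟩
  | down φ hA hx hm => exact ⟨.down φ hA hx, c.mark, fun _ => rfl, hm⟩

theorem HPath.ev_nil (x : Cell X) :
    (HPath.nil (F := F) x).ev = Iposet.Between.id (F.obj x.1) := by
  rw [HPath.ev]

theorem HPath.ev_snoc {x y z : Cell X} (p : HPath F X x y) (s : Step F X y z) :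
    (HPath.snoc p s).ev = p.ev.glue s.ev := by
  rw [HPath.ev]

/-- Every path yields a run on any set `E` that contains its events. -/
theorem HPath.exists_run (evt : E → E → Prop) (lab : E → Act) {x y : Cell X} (p : HPath F X x y)
    {R : Iposet.Between (F.obj x.1) (F.obj y.1)} (hR : p.ev = R)
    (g : R.P.carrier → E) (hg : Function.Injective g)
    (hevt : ∀ u v, R.P.evt u v → evt (g u) (g v)) (hlab : ∀ u, lab (g u) = R.P.lab u) :
    ∃ (n : ℕ) (c : ℕ → MarkedCell F X E) (b t : E → ℕ), Run evt lab b t n c ∧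
      Realizes evt lab b t n R.P g ∧ (c 0).cell = x ∧ c n = ⟨y, fun i => g (R.tgt i)⟩ := by
  classical
  induction p with
  | nil =>
    rw [HPath.ev_nil] at hR
    subst hR
    have hr : ∀ e, (∃ i, g i = e) ↔ (if ∃ i, g i = e then 0 else 1) ≤ 0 := fun e => by
      split_ifs with h <;> simp [h]
    -- Elements of `E` that mark no event get birth time `1`, after the end of this run.
    refine ⟨0, fun _ => ⟨x, g⟩, fun e => if ∃ i, g i = e then 0 else 1, fun _ => 0, ?_, ?_, rfl, rfl⟩
    · refine ⟨fun k hk => (Nat.not_lt_zero _ hk).elim, fun _ _ => hg, fun k hk e => ?_,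
        fun _ _ => hevt, fun _ _ => hlab⟩
      rw [Nat.le_zero.1 hk]
      exact (hr e).trans (by simp)
    · refine ⟨hg, hr, fun i => ?_, fun i => ?_, fun i j => ?_, fun i j h _ _ => hevt i j h, hlab⟩
      · exact iff_of_true (Set.mem_univ _) (if_pos ⟨i, rfl⟩)
      · exact iff_of_true (Set.mem_univ _) le_rfl
      · exact iff_of_false id (by simp)
  | @snoc y z p s ih =>
    rw [HPath.ev_snoc] at hR
    subst hR
    let f := p.ev.interfaceIso s.ev
    have hinr : Function.Injective fun u => g (f.inr u) := hg.comp f.inr_injective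
    obtain ⟨n, c, b, t, hrun, hre, h0, hn⟩ := ih rfl (fun u => g (f.inl u)) (hg.comp f.inl_injective)
      (fun u v h => hevt _ _ (f.evt_inl_iff.2 h)) (fun u => hlab (f.inl u))
    let m : Fin (F.obj z.1).n → E := fun i => g (f.inr (s.ev.tgt i))
    -- Elements of `E` outside the glued iposet get birth time `n + 2`, again after the end of the
    -- run.
    let b' : E → ℕ := fun e =>
      if ∃ u, g (f.inl u) = e then b e else if ∃ u, g (f.inr u) = e then n + 1 else n + 2
    -- The old `t` may exceed `n`; capping it there makes every event missing from the new cell dead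
    -- at time `n + 1` and changes no comparison with times up to `n`.
    let t' : E → ℕ := fun e => if ∃ i, m i = e then n + 1 else min (t e) n
    have hb' : ∀ u, b' (g (f.inl u)) = b (g (f.inl u)) := fun u => if_pos ⟨u, rfl⟩
    have hbn : ∀ e, b' e ≤ n ↔ b e ≤ n := fun e => by
      rw [← hre.exists_iff]
      by_cases h : ∃ u, g (f.inl u) = e
      · have := (hre.exists_iff e).1 h
        simp [b', h, this]
      · simp only [b', h, if_false, iff_false]
        split_ifs <;> omega
    have hS : ∀ u, u ∈ s.ev.P.S ↔ b' (g (f.inr u)) ≤ n := fun u => by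
      rw [hbn, ← hre.exists_iff]
      constructor
      · intro hu
        obtain ⟨i, rfl⟩ := s.ev.exists_src hu
        exact ⟨_, congrArg g (p.ev.inl_tgt s.ev i)⟩
      · rintro ⟨x, hx⟩
        obtain ⟨h, rfl⟩ := f.inl_eq_inr.1 (hg hx)
        exact (f.toEquiv ⟨x, h⟩).2
    have hT : ∀ u, u ∈ s.ev.P.T ↔ n + 1 ≤ t' (g (f.inr u)) := fun u => by
      constructor
      · intro hu
        obtain ⟨i, rfl⟩ := s.ev.exists_tgt hu
        exact (if_pos ⟨i, rfl⟩ : t' _ = n + 1).ge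
      · intro hu
        by_cases h : ∃ i, m i = g (f.inr u)
        · obtain ⟨i, hi⟩ := h
          rw [← hinr hi]
          exact (s.ev.tgt i).2
        · simp only [t', h, if_false] at hu
          omega
    have ht' : ∀ u, ∀ k ≤ n, k ≤ t' (g (f.inl u)) ↔ k ≤ t (g (f.inl u)) := fun u k hk => by
      by_cases h : ∃ i, m i = g (f.inl u)
      · obtain ⟨i, hi⟩ := h
        obtain ⟨hu, -⟩ := f.inl_eq_inr.1 (hg hi).symm
        have := (hre.mem_T u).1 hu
        have h' : t' (g (f.inl u)) = n + 1 := if_pos ⟨i, hi⟩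
        omega
      · simp only [t', h, if_false]
        omega
    have hb_new : ∀ e, b' e = n + 1 ↔ (¬ ∃ u, g (f.inl u) = e) ∧ ∃ u, g (f.inr u) = e := fun e => by
      by_cases h : ∃ u, g (f.inl u) = e
      · have := (hre.exists_iff e).1 h
        simp only [b', h, if_true, not_true, false_and, iff_false]
        omega
      · by_cases h' : ∃ u, g (f.inr u) = e <;> simp [b', h, h']
    have hle : ∀ u, b' (g (f.inr u)) ≤ n + 1 := fun u => by
      by_cases h : ∃ v, g (f.inl v) = g (f.inr u)
      · exact ((hbn _).2 ((hre.exists_iff _).1 h)).trans n.le_succ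
      · exact ((hb_new _).2 ⟨h, u, rfl⟩).le
    have hre' : Realizes evt lab b' t' (n + 1) _ g :=
      Realizes.glue f g (hre.congr hbn hb' ht') hinr s.not_prec s.S_or_T hS hle hT
        (fun e he => ((hb_new e).1 he).2) (fun u v h => hevt _ _ (f.evt_inr_iff.2 h))
        (fun u => (hlab (f.inr u)).trans (f.lab_inr u))
    refine ⟨n + 1, fun k => if k ≤ n then c k else ⟨z, m⟩, b', t', ?_, hre', by simpa using h0,
      by simp [m]; rfl⟩
    have hcases : ∀ {motive : ℕ → MarkedCell F X E → Prop}, (∀ k ≤ n, motive k (c k)) →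
        motive (n + 1) ⟨z, m⟩ → ∀ k ≤ n + 1, motive k (if k ≤ n then c k else ⟨z, m⟩) := by
      intro motive h h' k hk
      split_ifs with hkn
      · exact h k hkn
      · rwa [show k = n + 1 by omega]
    refine ⟨fun k hk => ?_, hcases (motive := fun _ d => Function.Injective d.mark) hrun.injective ?_,
      hcases (motive := fun k d => ∀ e, (∃ i, d.mark i = e) ↔ b' e ≤ k ∧ k ≤ t' e) ?_ ?_,
      hcases (motive := fun _ d => ∀ i j, i < j → evt (d.mark i) (d.mark j)) hrun.evt ?_,
      hcases (motive := fun _ d => ∀ i, lab (d.mark i) = (F.obj d.cell.1).lab i) hrun.lab ?_⟩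
    · rw [if_pos (Nat.lt_succ_iff.1 hk)]
      split_ifs with hk'
      · exact hrun.step k hk'
      · rw [show k = n by omega, hn]
        convert s.markedStep (fun u => g (f.inr u)) using 2
        funext i
        exact congrArg g (p.ev.inl_tgt s.ev i)
    · exact hinr.comp (Subtype.val_injective.comp s.ev.tgt.injective)
    · intro k hk e
      rw [hrun.exists_iff k hk]
      by_cases h : ∃ u, g (f.inl u) = e
      · obtain ⟨u, rfl⟩ := h
        rw [hb', ht' u k hk]
      · have h1 := mt (hre.exists_iff e).2 h
        have h2 := mt (hbn e).1 h1
        exact iff_of_false (fun h => h1 (h.1.trans hk)) (fun h => h2 (h.1.trans hk))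
    · intro e
      constructor
      · rintro ⟨i, rfl⟩
        exact ⟨hle _, (if_pos ⟨i, rfl⟩ : t' _ = n + 1).ge⟩
      · rintro ⟨-, h⟩
        by_contra hi
        simp only [t', hi, if_false] at h
        omega
    · intro i j hij
      exact hevt _ _ (f.evt_inr_iff.2 ((s.ev.tgt_iso.evt_iff i j).2 hij))
    · intro i
      exact ((hlab _).trans (f.lab_inr _)).trans (s.ev.tgt_iso.lab_eq i)

/-- Every run is the run of a path. -/
theorem Run.exists_path {evt : E → E → Prop} {lab : E → Act} {b t : E → ℕ} {n : ℕ}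
    {c : ℕ → MarkedCell F X E} (hc : Run evt lab b t n c) (hbt : ∀ e, b e ≤ t e) :
    ∀ k ≤ n, ∃ (p : HPath F X (c 0).cell (c k).cell)
      (R : Iposet.Between (F.obj (c 0).cell.1) (F.obj (c k).cell.1)) (g : R.P.carrier → E),
      p.ev = R ∧ Realizes evt lab b t k R.P g ∧ ∀ i, g (R.tgt i) = (c k).mark i := by
  intro k
  induction k with
  | zero =>
    intro _
    have hr := hc.exists_iff 0 (Nat.zero_le _)
    have hb : ∀ i, b ((c 0).mark i) = 0 := fun i => Nat.le_zero.1 ((hr _).1 ⟨i, rfl⟩).1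
    refine ⟨.nil _, Iposet.Between.id _, (c 0).mark, HPath.ev_nil _,
      ⟨hc.injective 0 (Nat.zero_le _), fun e => (hr e).trans (by simp), fun i => ?_, fun i => ?_,
        fun i j => ?_, fun i j h _ _ => hc.evt 0 (Nat.zero_le _) i j h, hc.lab 0 (Nat.zero_le _)⟩,
      fun _ => rfl⟩
    · exact iff_of_true (Set.mem_univ _) (hb i)
    · exact iff_of_true (Set.mem_univ _) (Nat.zero_le _)
    · exact iff_of_false id fun h => Nat.not_lt_zero _ (h.trans_eq (hb j))
  | succ k ih =>
    intro hk
    obtain ⟨p, _, g, rfl, hg, hgt⟩ := ih (Nat.le_of_succ_le hk)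
    obtain ⟨s, h, hsrc, htgt⟩ := (hc.step k hk).exists_step
    have hk' := Nat.le_of_succ_le hk
    let f := p.ev.interfaceIso s.ev
    let G : f.Carrier → E := Sum.elim g fun u => h u
    -- On the interface both markings name the events of the `k`-th cell, so they agree there.
    have hG : ∀ u, G (f.inr u) = h u := fun u => by
      by_cases hu : u ∈ s.ev.P.S
      · obtain ⟨i, rfl⟩ := s.ev.exists_src hu
        rw [← p.ev.inl_tgt s.ev i, hsrc, ← hgt]
        rfl
      · simp [G, Iposet.InterfaceIso.inr, hu]
    have hST := s.S_or_T
    have hinj : Function.Injective h := by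
      intro u v huv
      rcases hST with hS | hT
      · obtain ⟨i, rfl⟩ := s.ev.exists_src (hS u)
        obtain ⟨j, rfl⟩ := s.ev.exists_src (hS v)
        rw [hsrc, hsrc] at huv
        rw [hc.injective k hk' huv]
      · obtain ⟨i, rfl⟩ := s.ev.exists_tgt (hT u)
        obtain ⟨j, rfl⟩ := s.ev.exists_tgt (hT v)
        rw [htgt, htgt] at huv
        rw [hc.injective _ hk huv]
    have hsrc' : ∀ e, (∃ u ∈ s.ev.P.S, h u = e) ↔ b e ≤ k ∧ k ≤ t e := fun e => by
      rw [← hc.exists_iff k hk']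
      constructor
      · rintro ⟨u, hu, rfl⟩
        obtain ⟨i, rfl⟩ := s.ev.exists_src hu
        exact ⟨i, (hsrc i).symm⟩
      · rintro ⟨i, rfl⟩
        exact ⟨_, (s.ev.src i).2, hsrc i⟩
    have htgt' : ∀ e, (∃ u ∈ s.ev.P.T, h u = e) ↔ b e ≤ k + 1 ∧ k + 1 ≤ t e := fun e => by
      rw [← hc.exists_iff _ hk]
      constructor
      · rintro ⟨u, hu, rfl⟩
        obtain ⟨i, rfl⟩ := s.ev.exists_tgt hu
        exact ⟨i, (htgt i).symm⟩
      · rintro ⟨i, rfl⟩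
        exact ⟨_, (s.ev.tgt i).2, htgt i⟩
    have hST' : ∀ u, u ∈ s.ev.P.S ∨ u ∈ s.ev.P.T := fun u => hST.imp (fun h => h u) fun h => h u
    have hS1 : ∀ u ∈ s.ev.P.S, b (h u) ≤ k ∧ k ≤ t (h u) := fun u hu => (hsrc' _).1 ⟨u, hu, rfl⟩
    have hT1 : ∀ u ∈ s.ev.P.T, b (h u) ≤ k + 1 ∧ k + 1 ≤ t (h u) := fun u hu =>
      (htgt' _).1 ⟨u, hu, rfl⟩
    refine ⟨p.snoc s, p.ev.glue s.ev, G, HPath.ev_snoc p s,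
      Realizes.glue f G hg ?_ s.not_prec hST ?_ ?_ ?_ ?_ ?_ ?_, ?_⟩
    · simpa only [hG] using hinj
    · intro u
      rw [hG]
      -- An event of the step that was born by time `k` is alive in the `k`-th cell, so it is marked
      -- by some element of `S`; injectivity of the marking identifies that element with `u`.
      refine ⟨fun hu => (hS1 u hu).1, fun hu => (hST' u).elim id fun hT => ?_⟩
      obtain ⟨v, hv, hvu⟩ := (hsrc' (h u)).2 ⟨hu, k.le_succ.trans (hT1 u hT).2⟩
      rwa [← hinj hvu]
    · intro u
      rw [hG]
      exact (hST' u).elim (fun hu => (hS1 u hu).1.trans k.le_succ) fun hu => (hT1 u hu).1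
    · intro u
      rw [hG]
      refine ⟨fun hu => (hT1 u hu).2, fun hu => (hST' u).elim (fun hS => ?_) id⟩
      obtain ⟨v, hv, hvu⟩ := (htgt' (h u)).2 ⟨(hS1 u hS).1.trans k.le_succ, hu⟩
      rwa [← hinj hvu]
    · intro e he
      -- By `hbt`, an event born at time `k + 1` is alive then, so it does occur in the next cell.
      obtain ⟨u, -, hu⟩ := (htgt' e).2 ⟨he.le, he ▸ hbt e⟩
      exact ⟨u, (hG u).trans hu⟩
    · intro u v huv
      rw [hG, hG]
      rcases hST with hS | hT
      · obtain ⟨i, rfl⟩ := s.ev.exists_src (hS u)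
        obtain ⟨j, rfl⟩ := s.ev.exists_src (hS v)
        rw [hsrc, hsrc]
        exact hc.evt k hk' i j ((s.ev.src_iso.evt_iff i j).1 huv)
      · obtain ⟨i, rfl⟩ := s.ev.exists_tgt (hT u)
        obtain ⟨j, rfl⟩ := s.ev.exists_tgt (hT v)
        rw [htgt, htgt]
        exact hc.evt _ hk i j ((s.ev.tgt_iso.evt_iff i j).1 huv)
    · intro u
      rw [hG]
      rcases hST' u with hu | hu
      · obtain ⟨i, rfl⟩ := s.ev.exists_src hu
        rw [hsrc, s.ev.src_iso.lab_eq]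
        exact hc.lab k hk' i
      · obtain ⟨i, rfl⟩ := s.ev.exists_tgt hu
        rw [htgt, s.ev.tgt_iso.lab_eq]
        exact hc.lab _ hk i
    · intro i
      exact (hG _).trans (htgt i)

end Runs

/-! ### Refining runs -/

section Refine

variable {Act : Type v} {C : Type v} [Category.{0} C] {F : C ⥤ LoWord Act} {X : Cᵒᵖ ⥤ Type w}
  {E : Type} {U U' D D' : Set E} {z z' c d : MarkedCell F X E}

/-- The marked cell `z` is the face of `c` in which the events in `U` are unstarted and the events
in `D` are done. -/
def MarkedCell.IsFace (U D : Set E) (z c : MarkedCell F X E) : Prop :=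
  ∃ φ : z.cell.1 ⟶ c.cell.1, X.map φ.op c.cell.2 = z.cell.2 ∧
    (∀ i, c.mark (Coface.emb (F.map φ) i) = z.mark i) ∧
    Coface.A (F.map φ) = c.mark ⁻¹' U ∧ Coface.B (F.map φ) = c.mark ⁻¹' D

theorem Coface.emb_map_comp {a b c : C} (θ : a ⟶ b) (φ : b ⟶ c) (i) :
    Coface.emb (F.map (θ ≫ φ)) i = Coface.emb (F.map φ) (Coface.emb (F.map θ) i) := by
  rw [F.map_comp]; rfl

theorem Coface.A_map_comp {a b c : C} (θ : a ⟶ b) (φ : b ⟶ c) :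
    Coface.A (F.map (θ ≫ φ)) =
      Coface.emb (F.map φ) '' Coface.A (F.map θ) ∪ Coface.A (F.map φ) := by
  rw [F.map_comp]; rfl

theorem Coface.B_map_comp {a b c : C} (θ : a ⟶ b) (φ : b ⟶ c) :
    Coface.B (F.map (θ ≫ φ)) =
      Coface.emb (F.map φ) '' Coface.B (F.map θ) ∪ Coface.B (F.map φ) := by
  rw [F.map_comp]; rfl

/-! ### Faces of marked cells. -/

namespace MarkedCell

theorem IsFace.refl (hU : c.mark ⁻¹' U = ∅) (hD : c.mark ⁻¹' D = ∅) : IsFace U D c c := by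
  refine ⟨𝟙 _, by simp, fun i => ?_, ?_, ?_⟩
  · rw [F.map_id]; rfl
  · rw [F.map_id, hU]; rfl
  · rw [F.map_id, hD]; rfl

theorem exists_isFace (Φ : FaceSystem F) (c : MarkedCell F X E) (h : Disjoint U D)
    (hS : ∀ i ∈ Φ.S c.cell.1, c.mark i ∉ U) (hT : ∀ i ∈ Φ.T c.cell.1, c.mark i ∉ D) :
    ∃ z, IsFace U D z c := by
  obtain ⟨a, φ, hA, hB⟩ := Φ.exists_face c.cell.1 (c.mark ⁻¹' U) (c.mark ⁻¹' D) (h.preimage _)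
    (Set.disjoint_right.2 hS) (Set.disjoint_right.2 hT)
  exact ⟨⟨⟨a, X.map φ.op c.cell.2⟩, fun i => c.mark (Coface.emb (F.map φ) i)⟩, φ, rfl,
    fun _ => rfl, hA, hB⟩

theorem IsFace.exists_mark (h : IsFace U D z c) (e : E) :
    (∃ i, z.mark i = e) ↔ (∃ i, c.mark i = e) ∧ e ∉ U ∧ e ∉ D := by
  obtain ⟨φ, -, hm, hA, hB⟩ := h
  constructor
  · rintro ⟨i, rfl⟩
    have h1 := Coface.emb_notMem_A (F.map φ) i
    have h2 := Coface.emb_notMem_B (F.map φ) i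
    rw [hA] at h1
    rw [hB] at h2
    exact ⟨⟨_, hm i⟩, hm i ▸ h1, hm i ▸ h2⟩
  · rintro ⟨⟨j, rfl⟩, hU, hD⟩
    obtain ⟨i, rfl⟩ := Coface.exists_emb (F.map φ) j (hA ▸ hU) (hB ▸ hD)
    exact ⟨i, (hm i).symm⟩

/-- The face with more unstarted events factors through the other one. As the same events are done
in both, the connecting coface terminates nothing. -/
theorem IsFace.markedStep_up (Φ : FaceSystem F) (h : IsFace U D z c) (h' : IsFace U' D z' c)
    (hU : U' ⊆ U) : MarkedStep z z' := by
  obtain ⟨φ, hx, hm, hA, hB⟩ := h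
  obtain ⟨φ', hx', hm', hA', hB'⟩ := h'
  obtain ⟨θ, rfl⟩ := Φ.factor φ' φ (by rw [hA, hA']; exact Set.preimage_mono hU) (by rw [hB, hB'])
  refine .up θ ?_ ?_ fun i => ?_
  · rw [Coface.B_map_comp, ← hB'] at hB
    refine Set.eq_empty_of_forall_notMem fun i hi => Coface.emb_notMem_B (F.map φ') i ?_
    rw [← hB]
    exact Or.inl ⟨i, hi, rfl⟩
  · rw [← hx', ← hx, op_comp, X.map_comp]; rfl
  · rw [← hm', ← hm, Coface.emb_map_comp]

theorem IsFace.markedStep_down (Φ : FaceSystem F) (h : IsFace U D z c) (h' : IsFace U D' z' c)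
    (hD : D ⊆ D') : MarkedStep z z' := by
  obtain ⟨φ, hx, hm, hA, hB⟩ := h
  obtain ⟨φ', hx', hm', hA', hB'⟩ := h'
  obtain ⟨θ, rfl⟩ := Φ.factor φ φ' (by rw [hA, hA']) (by rw [hB, hB']; exact Set.preimage_mono hD)
  refine .down θ ?_ ?_ fun i => ?_
  · rw [Coface.A_map_comp, ← hA] at hA'
    refine Set.eq_empty_of_forall_notMem fun i hi => Coface.emb_notMem_A (F.map φ) i ?_
    rw [← hA']
    exact Or.inl ⟨i, hi, rfl⟩
  · rw [← hx', ← hx, op_comp, X.map_comp]; rfl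
  · rw [← hm', ← hm, Coface.emb_map_comp]

/-- A face of a cell is a face of the next cell of a run, if the events that are born in between
are unstarted and the events that die in between are done. -/
theorem IsFace.of_markedStep (Φ : FaceSystem F) (h : IsFace U D z c) (hs : MarkedStep c d)
    (hUD : Disjoint U D) (hc : Function.Injective c.mark) (hd : Function.Injective d.mark)
    (hU : ∀ e ∉ U, (∃ i, d.mark i = e) → ∃ i, c.mark i = e)
    (hD : ∀ e ∉ D, (∃ i, c.mark i = e) → ∃ i, d.mark i = e) : IsFace U D z d := by
  obtain ⟨φ, hx, hm, hA, hB⟩ := h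
  cases hs with
  | up ψ hψ hy hn =>
    -- Only events of `U` are new in `d`. Events of `D`, being outside `U`, are therefore inherited
    -- from `c` as well.
    have key : ∀ j, d.mark j ∉ U → ∃ i, Coface.emb (F.map ψ) i = j := fun j hj => by
      obtain ⟨i, hi⟩ := hU _ hj ⟨j, rfl⟩
      exact ⟨i, hd ((hn i).trans hi)⟩
    refine ⟨φ ≫ ψ, ?_, fun i => ?_, ?_, ?_⟩
    · rw [← hx, ← hy, op_comp, X.map_comp]; rfl
    · rw [Coface.emb_map_comp, hn, hm]
    · rw [Coface.A_map_comp, hA]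
      ext j
      constructor
      · rintro (⟨i, hi, rfl⟩ | hj)
        · rw [Set.mem_preimage, hn]; exact hi
        · by_contra hj'
          obtain ⟨i, rfl⟩ := key j hj'
          exact Coface.emb_notMem_A (F.map ψ) i hj
      · intro hj
        by_cases hj' : j ∈ Coface.A (F.map ψ)
        · exact Or.inr hj'
        · obtain ⟨i, rfl⟩ := Coface.exists_emb (F.map ψ) j hj' (by simp [hψ])
          exact Or.inl ⟨i, by rwa [Set.mem_preimage, hn] at hj, rfl⟩
    · rw [Coface.B_map_comp, hB, hψ, Set.union_empty]
      ext j
      constructor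
      · rintro ⟨i, hi, rfl⟩
        rw [Set.mem_preimage, hn]; exact hi
      · intro hj
        obtain ⟨i, rfl⟩ := key j (Set.disjoint_right.1 hUD hj)
        exact ⟨i, by rwa [Set.mem_preimage, hn] at hj, rfl⟩
  | down ψ hψ hy hn =>
    -- All events terminated by this step lie in `D`, so the face of `c` factors through `d`.
    obtain ⟨θ, rfl⟩ := Φ.factor ψ φ (by simp [hψ]) (by
      intro j hj
      rw [hB]
      by_contra hj'
      obtain ⟨i, hi⟩ := hD _ hj' ⟨j, rfl⟩
      rw [← hn] at hi
      exact Coface.emb_notMem_B (F.map ψ) i (hc hi ▸ hj))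
    refine ⟨θ, ?_, fun i => ?_, ?_, ?_⟩
    · rw [← hx, ← hy, op_comp, X.map_comp]; rfl
    · rw [← hn, ← hm, Coface.emb_map_comp]
    · ext i
      rw [Set.mem_preimage, ← hn, ← Set.mem_preimage, ← hA, F.map_comp]
      exact (Coface.mem_comp_A (F.map θ) (F.map ψ) i).symm
    · ext i
      rw [Set.mem_preimage, ← hn, ← Set.mem_preimage, ← hB, F.map_comp]
      exact (Coface.mem_comp_B (F.map θ) (F.map ψ) i).symm

end MarkedCell

/-! ### Interface events along a run, and refinement to new times. -/

namespace Run

open MarkedCell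

variable {evt evt' : E → E → Prop} {lab : E → Act} {b t b' t' : E → ℕ} {n n' : ℕ}
  {c : ℕ → MarkedCell F X E}

/-- Up-steps cannot start an event of the source interface, and cofaces preserve and reflect
membership in it, so such an event can be traced back to the first cell. -/
theorem birth_eq_zero (Φ : FaceSystem F) (hc : Run evt lab b t n c) :
    ∀ k ≤ n, ∀ i ∈ Φ.S (c k).cell.1, b ((c k).mark i) = 0 := by
  intro k
  induction k with
  | zero => exact fun hk i _ => Nat.le_zero.1 ((hc.exists_iff 0 hk _).1 ⟨i, rfl⟩).1
  | succ k ih =>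
    intro hk i hi
    replace ih := ih (Nat.le_of_succ_le hk)
    cases hc.step k hk with
    | up φ hB _ hm =>
      obtain ⟨j, rfl⟩ := Coface.exists_emb (F.map φ) i
        (Set.disjoint_right.1 (Φ.disj_S φ) hi) (by simp [hB])
      rw [hm]
      exact ih j ((Φ.emb_mem_S φ j).1 hi)
    | down φ hA _ hm =>
      rw [← hm]
      exact ih _ ((Φ.emb_mem_S φ i).2 hi)

/-- Dually, an event of the target interface can be followed to the last cell. -/
theorem le_death (Φ : FaceSystem F) (hc : Run evt lab b t n c) {k : ℕ} (hk : k ≤ n) :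
    ∀ i ∈ Φ.T (c k).cell.1, n ≤ t ((c k).mark i) := by
  induction hk using Nat.decreasingInduction with
  | self => exact fun i _ => ((hc.exists_iff n le_rfl _).1 ⟨i, rfl⟩).2
  | of_succ k hk ih =>
    intro i hi
    cases hc.step k hk with
    | up φ hB _ hm =>
      rw [← hm]
      exact ih _ ((Φ.emb_mem_T φ i).2 hi)
    | down φ hA _ hm =>
      obtain ⟨j, rfl⟩ := Coface.exists_emb (F.map φ) i (by simp [hA])
        (Set.disjoint_right.1 (Φ.disj_T φ) hi)
      rw [hm]
      exact ih j ((Φ.emb_mem_T φ j).1 hi)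

/-- Every event born after `j` lies in `U` and every event that dies before `k` lies in `D`, so
`IsFace.of_markedStep` applies to each step in between. -/
theorem isFace_of_le (Φ : FaceSystem F) (hc : Run evt lab b t n c) (hUD : Disjoint U D) {j k : ℕ}
    (hjk : j ≤ k) (hk : k ≤ n) (hU : ∀ e ∉ U, b e ≤ j) (hD : ∀ e ∉ D, k ≤ t e)
    (h : IsFace U D z (c j)) : IsFace U D z (c k) := by
  induction k, hjk using Nat.le_induction with
  | base => exact h
  | succ k hjk ih =>
    have hk' := Nat.le_of_succ_le hk
    refine (ih hk' fun e he => Nat.le_of_succ_le (hD e he)).of_markedStep Φ (hc.step k hk) hUD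
      (hc.injective k hk') (hc.injective _ hk) (fun e he h => ?_) (fun e he h => ?_)
    · rw [hc.exists_iff _ hk] at h
      exact (hc.exists_iff k hk' e).2 ⟨(hU e he).trans hjk, Nat.le_of_succ_le h.2⟩
    · rw [hc.exists_iff _ hk'] at h
      exact (hc.exists_iff _ hk e).2 ⟨h.1.trans k.le_succ, hD e he⟩

/-- A run with birth times `b` and death times `t` yields a run with times `b'` and `t'`, if every
time `k` of the latter has a time `κ k` of the former at which the events that are started at time
`k` are born, and the events that are not done at time `k` have not died. -/
theorem refine (Φ : FaceSystem F) (hc : Run evt lab b t n c) (κ : ℕ → ℕ)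
    (hbt' : ∀ e, b' e ≤ t' e) (hbn' : ∀ e, b' e ≤ n') (hb0 : ∀ e, b e = 0 → b' e = 0)
    (htn : ∀ e, n ≤ t e → n' ≤ t' e)
    (hκ : Monotone κ) (hκ0 : κ 0 = 0) (hκn : κ n' = n)
    (hb : ∀ k ≤ n', ∀ e, b' e ≤ k → b e ≤ κ k) (ht : ∀ k ≤ n', ∀ e, k ≤ t' e → κ k ≤ t e)
    (hstep : ∀ k < n', (∀ e, k ≤ t' e → k + 1 ≤ t' e) ∨
      ((∀ e, b' e ≤ k + 1 → b' e ≤ k) ∧ κ (k + 1) = κ k))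
    (hevt : ∀ e e', evt e e' → b' e ≤ t' e' → b' e' ≤ t' e → evt' e e') :
    ∃ c' : ℕ → MarkedCell F X E, Run evt' lab b' t' n' c' ∧ c' 0 = c 0 ∧ c' n' = c n := by
  have hUD : ∀ k, Disjoint {e | k < b' e} {e | t' e < k} := fun k =>
    Set.disjoint_left.2 fun e (h : k < b' e) (h' : t' e < k) =>
      absurd (hbt' e) (not_le.2 (h'.trans h))
  have hκle : ∀ k ≤ n', κ k ≤ n := fun k hk => hκn ▸ hκ hk
  -- The end cells are chosen to be `c 0` and `c n` themselves, not merely some faces with the same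
  -- events, so that the endpoints are kept. Indices beyond `n'` get the default `c 0`.
  have hex : ∀ k, ∃ z : MarkedCell F X E, k ≤ n' →
      IsFace {e | k < b' e} {e | t' e < k} z (c (κ k)) ∧ (k = 0 → z = c 0) ∧
        (k = n' → z = c n) := by
    intro k
    by_cases hk : k ≤ n'
    swap
    · exact ⟨c 0, fun h => (hk h).elim⟩
    by_cases hk0 : k = 0
    · subst hk0
      refine ⟨c 0, fun _ => ⟨?_, fun _ => rfl, fun h => ?_⟩⟩
      · rw [hκ0]
        refine IsFace.refl (Set.eq_empty_of_forall_notMem fun i (hi : 0 < b' _) => ?_)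
          (Set.eq_empty_of_forall_notMem fun i hi => Nat.not_lt_zero _ hi)
        have := hb0 _ (Nat.le_zero.1 ((hc.exists_iff 0 (Nat.zero_le _) _).1 ⟨i, rfl⟩).1)
        omega
      · rw [← hκn, ← h, hκ0]
    by_cases hkn : k = n'
    · subst hkn
      refine ⟨c n, fun _ => ⟨?_, fun h => (hk0 h).elim, fun _ => rfl⟩⟩
      rw [hκn]
      refine IsFace.refl (Set.eq_empty_of_forall_notMem fun i (hi : k < b' _) => ?_)
        (Set.eq_empty_of_forall_notMem fun i (hi : t' _ < k) => ?_)
      · exact absurd (hbn' _) (not_le.2 hi)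
      · exact absurd (htn _ ((hc.exists_iff n le_rfl _).1 ⟨i, rfl⟩).2) (not_le.2 hi)
    · obtain ⟨z, hz⟩ := exists_isFace Φ (c (κ k)) (hUD k)
        (fun i hi (h : k < b' _) => by
          have := hb0 _ (hc.birth_eq_zero Φ _ (hκle k hk) i hi); omega)
        (fun i hi (h : t' _ < k) => by
          have := htn _ (hc.le_death Φ (hκle k hk) i hi); omega)
      exact ⟨z, fun _ => ⟨hz, fun h => (hk0 h).elim, fun h => (hkn h).elim⟩⟩
  choose c' hc' using hex
  refine ⟨c', ⟨fun k hk => ?_, fun k hk => ?_, fun k hk e => ?_, fun k hk i j hij => ?_,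
    fun k hk i => ?_⟩, (hc' 0 (Nat.zero_le _)).2.1 rfl, (hc' n' le_rfl).2.2 rfl⟩
  · have h1 := (hc' k hk.le).1
    have h2 := (hc' (k + 1) hk).1
    rcases hstep k hk with h | ⟨h, hk'⟩
    · have hD : {e | t' e < k + 1} = {e | t' e < k} := by
        ext e
        have := h e
        simp only [Set.mem_ofPred_eq]
        omega
      rw [hD] at h2
      -- Carrying the `k`-th face along the old run to time `κ (k + 1)` makes it and its successor
      -- faces of one cell with the same events done.
      refine IsFace.markedStep_up Φ (hc.isFace_of_le Φ (hUD k) (hκ k.le_succ) (hκle _ hk)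
        (fun e he => hb k hk.le e (not_lt.1 he))
        (fun e he => ht (k + 1) hk e (h e (not_lt.1 he))) h1) h2 ?_
      exact fun e (he : k + 1 < b' e) => show k < b' e by omega
    · have hU : {e | k + 1 < b' e} = {e | k < b' e} := by
        ext e
        have := h e
        simp only [Set.mem_ofPred_eq]
        omega
      rw [hU, hk'] at h2
      exact IsFace.markedStep_down Φ h1 h2 fun e (he : t' e < k) => show t' e < k + 1 by omega
  · obtain ⟨φ, -, hm, -⟩ := (hc' k hk).1
    intro i j hij
    rw [← hm, ← hm] at hij
    exact (Coface.emb (F.map φ)).injective (hc.injective _ (hκle k hk) hij)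
  · rw [(hc' k hk).1.exists_mark, hc.exists_iff _ (hκle k hk)]
    simp only [Set.mem_ofPred_eq, not_lt]
    exact ⟨fun h => h.2, fun h => ⟨⟨hb k hk e h.1, ht k hk e h.2⟩, h⟩⟩
  · have hi := (hc' k hk).1.exists_mark _ |>.1 ⟨i, rfl⟩ |>.2
    have hj := (hc' k hk).1.exists_mark _ |>.1 ⟨j, rfl⟩ |>.2
    simp only [Set.mem_ofPred_eq, not_lt] at hi hj
    refine hevt _ _ ?_ (hi.1.trans hj.2) (hj.1.trans hi.2)
    obtain ⟨φ, -, hm, -⟩ := (hc' k hk).1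
    rw [← hm, ← hm]
    exact hc.evt _ (hκle k hk) _ _ ((Coface.emb (F.map φ)).lt_iff_lt.2 hij)
  · obtain ⟨φ, -, hm, -⟩ := (hc' k hk).1
    rw [← hm, hc.lab _ (hκle k hk)]
    exact Coface.lab_emb (F.map φ) i

end Run

end Refine

/-! ### Languages -/

section Lang

variable {Act : Type v} {C : Type v} [Category.{0} C] {F : C ⥤ LoWord Act} {X : Cᵒᵖ ⥤ Type w}

/-- The birth and death times of the path's own events are an interval representation; births do not
come after deaths because precedence is irreflexive. -/
theorem HPath.isInterval {x y : Cell X} (p : HPath F X x y) : p.ev.P.IsInterval := by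
  obtain ⟨n, c, b, t, -, hre, -⟩ := p.exists_run p.ev.P.evt p.ev.P.lab rfl id
    Function.injective_id (fun _ _ h => h) (fun _ => rfl)
  refine ⟨fun e => b e, fun e => t e, fun e => ?_, fun e e' => ?_⟩
  · exact Nat.cast_le.2 (not_lt.1 fun h => p.ev.P.prec_irrefl e ((hre.prec_iff e e).2 h))
  · rw [hre.prec_iff]
    exact Nat.cast_lt.symm

/-- Once all elements of `P` are born by time `n`, the marking is bijective, and precedence and
interfaces on both sides are read off from the same times. -/
theorem Realizes.iso {P R : Iposet Act} {b t : P.carrier → ℕ} {n : ℕ} {g : R.carrier → P.carrier}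
    (h : Realizes P.evt P.lab b t n R g) (hb : ∀ e, b e ≤ n) (hS : ∀ e, e ∈ P.S ↔ b e = 0)
    (hT : ∀ e, e ∈ P.T ↔ n ≤ t e) (hprec : ∀ e e', P.prec e e' ↔ t e < b e') : R.Iso P := by
  have hg : Function.Bijective g := ⟨h.injective, fun e => (h.exists_iff e).2 (hb e)⟩
  refine ⟨Equiv.ofBijective g hg, ⟨h.lab, ?_, ?_, fun x y hxy => ?_, h.evt⟩, fun x y => ?_⟩
  · ext e
    obtain ⟨x, rfl⟩ := hg.2 e
    rw [hS, ← h.mem_S]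
    exact h.injective.mem_set_image
  · ext e
    obtain ⟨x, rfl⟩ := hg.2 e
    rw [hT, ← h.mem_T]
    exact h.injective.mem_set_image
  · exact (h.prec_iff x y).2 ((hprec _ _).1 hxy)
  · exact (h.prec_iff x y).trans (hprec _ _).symm

theorem Run.exists_path_iso {P : Iposet Act} {b t : P.carrier → ℕ} {n : ℕ}
    {c : ℕ → MarkedCell F X P.carrier} (hc : Run P.evt P.lab b t n c) {x y : Cell X}
    (hx : (c 0).cell = x) (hy : (c n).cell = y) (hb : ∀ e, b e ≤ n)
    (hS : ∀ e, e ∈ P.S ↔ b e = 0) (hT : ∀ e, e ∈ P.T ↔ n ≤ t e)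
    (hprec : ∀ e e', P.prec e e' ↔ t e < b e') : ∃ p : HPath F X x y, p.ev.P.Iso P := by
  subst hx hy
  obtain ⟨p, _, g, rfl, hg, -⟩ := hc.exists_path
    (fun e => not_lt.1 fun h => P.prec_irrefl e ((hprec e e).2 h)) n le_rfl
  exact ⟨p, hg.iso hb hS hT hprec⟩

/-- An interval order on a finite set has a representation by natural numbers. -/
theorem Iposet.IsInterval.exists_nat {P : Iposet Act} (hP : P.IsInterval) :
    ∃ (N : ℕ) (b t : P.carrier → ℕ), (∀ e, b e ≤ N) ∧ (∀ e, t e ≤ N) ∧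
      ∀ e e', P.prec e e' ↔ t e < b e' := by
  classical
  have := P.finite
  have := Fintype.ofFinite P.carrier
  obtain ⟨β, τ, -, h⟩ := hP
  -- Each endpoint is replaced by the number of right endpoints strictly below it. If `τ e < β e'`,
  -- then `e` is counted for `β e'` but not for `τ e`, which makes the inequality strict.
  refine ⟨Fintype.card P.carrier, fun e => (Finset.univ.filter fun x => τ x < β e).card,
    fun e => (Finset.univ.filter fun x => τ x < τ e).card, fun e => Finset.card_le_univ _,
    fun e => Finset.card_le_univ _, fun e e' => ⟨fun he => ?_, fun he => ?_⟩⟩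
  · rw [h] at he
    refine Finset.card_lt_card (Finset.ssubset_iff_of_subset ?_ |>.2 ⟨e, ?_, ?_⟩)
    · intro x hx
      simp only [Finset.mem_filter_univ] at hx ⊢
      exact hx.trans he
    · simpa using he
    · simp
  · rw [h]
    by_contra he'
    refine absurd he (not_lt.2 (Finset.card_le_card ?_))
    intro x hx
    simp only [Finset.mem_filter_univ] at hx ⊢
    exact hx.trans_le (not_lt.1 he')

theorem HPath.exists_iso_of_subsumed (Φ : FaceSystem F) {x y : Cell X} (p : HPath F X x y)
    {P : Iposet Act} (hP : P.IsInterval) (hPp : P.Subsumed p.ev.P) :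
    ∃ q : HPath F X x y, q.ev.P.Iso P := by
  classical
  have := P.finite
  have := Fintype.ofFinite P.carrier
  obtain ⟨f, hf⟩ := hPp
  -- The run is marked by the events of `P`, but for now with the event order of the path, pulled
  -- back along the subsumption.
  obtain ⟨n, c, b, t, hrun, hre, h0, hn⟩ := p.exists_run
    (fun u v => p.ev.P.evt (f u) (f v)) P.lab rfl f.symm f.symm.injective
    (fun u v h => by simpa using h) (fun u => by rw [← hf.lab]; simp)
  have hbn : ∀ e, b e ≤ n := fun e => (hre.exists_iff e).1 ⟨f e, by simp⟩
  have hS : ∀ e, e ∈ P.S ↔ b e = 0 := fun e => by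
    have := hre.mem_S (f e)
    rwa [← hf.image_S, f.injective.mem_set_image, f.symm_apply_apply] at this
  have hT : ∀ e, e ∈ P.T ↔ n ≤ t e := fun e => by
    have := hre.mem_T (f e)
    rwa [← hf.image_T, f.injective.mem_set_image, f.symm_apply_apply] at this
  have hprec : ∀ e e', t e < b e' → P.prec e e' := fun e e' h =>
    hf.reflects_prec e e' ((hre.prec_iff _ _).2 (by simpa using h))
  obtain ⟨N, β, τ, hβ, hτ, hβτ⟩ := hP.exists_nat
  -- All births are at odd times or at `0` and all death times are odd, so steps from even times
  -- terminate nothing and steps from odd times start nothing. The end `2 * N + 3` is odd and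
  -- exceeds every `2 * τ e + 1`, so exactly the target events reach it.
  let b' : P.carrier → ℕ := fun e => if e ∈ P.S then 0 else 2 * β e + 1
  let t' : P.carrier → ℕ := fun e => if e ∈ P.T then 2 * N + 3 else 2 * τ e + 1
  have hb' : ∀ e, (e ∈ P.S ∧ b' e = 0) ∨ (e ∉ P.S ∧ b' e = 2 * β e + 1) := fun e => by
    by_cases h : e ∈ P.S <;> simp [b', h]
  have ht' : ∀ e, (e ∈ P.T ∧ t' e = 2 * N + 3) ∨ (e ∉ P.T ∧ t' e = 2 * τ e + 1) := fun e => by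
    by_cases h : e ∈ P.T <;> simp [t', h]
  have hbN : ∀ e, b' e ≤ 2 * N + 3 := fun e => by have := hb' e; have := hβ e; omega
  have hS' : ∀ e, e ∈ P.S ↔ b' e = 0 := fun e => by have := hb' e; grind
  have hT' : ∀ e, e ∈ P.T ↔ 2 * N + 3 ≤ t' e := fun e => by
    have := ht' e; have := hτ e; grind
  have hprec' : ∀ e e', P.prec e e' ↔ t' e < b' e' := fun e e' => by
    constructor
    · intro h
      have h1 : e ∉ P.T := fun he => P.T_maximal e he _ h
      have h2 : e' ∉ P.S := fun he => P.S_minimal e' he _ h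
      rw [hβτ] at h
      simp only [b', t', h1, h2, if_false]
      omega
    · intro h
      rw [hβτ]
      have := hb' e'; have := hβ e'; have := ht' e
      omega
  -- Below the end this is the earliest old time by which all events started at time `k` are born.
  -- The end is sent to `n`, so that the new run stops at the same cell.
  let κ : ℕ → ℕ := fun k =>
    if 2 * N + 3 ≤ k then n else Finset.univ.sup fun e => if b' e ≤ k then b e else 0
  have hκ_lt : ∀ k < 2 * N + 3, ∀ m, κ k ≤ m ↔ ∀ e, b' e ≤ k → b e ≤ m := fun k hk m => by
    simp only [κ, not_le.2 hk, if_false, Finset.sup_le_iff, Finset.mem_univ, true_imp_iff]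
    exact forall_congr' fun e => by split_ifs with h <;> simp [h]
  have hκ_ge : ∀ k, 2 * N + 3 ≤ k → κ k = n := fun k hk => if_pos hk
  have hb : ∀ k e, b' e ≤ k → b e ≤ κ k := fun k e he => by
    rcases lt_or_ge k (2 * N + 3) with hk | hk
    · exact (hκ_lt k hk _).1 le_rfl e he
    · rw [hκ_ge k hk]; exact hbn e
  obtain ⟨c', hc', hc0, hcn⟩ := hrun.refine (evt' := P.evt) (b' := b') (t' := t')
    (n' := 2 * N + 3) Φ κ
    (fun e => not_lt.1 fun h => P.prec_irrefl e ((hprec' e e).2 h)) hbN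
    (fun e he => (hS' e).1 ((hS e).2 he)) (fun e he => (hT' e).1 ((hT e).2 he))
    (by
      intro j k hjk
      rcases lt_or_ge j (2 * N + 3) with hj | hj
      · exact (hκ_lt j hj _).2 fun e he => hb k e (he.trans hjk)
      · rw [hκ_ge j hj, hκ_ge k (hj.trans hjk)])
    (Nat.le_zero.1 ((hκ_lt 0 (by omega) 0).2 fun e he =>
      ((hS e).1 ((hS' e).2 (Nat.le_zero.1 he))).le))
    (hκ_ge _ le_rfl) (fun k _ e he => hb k e he)
    (by
      intro k hk e he
      rcases hk.lt_or_eq with hk | rfl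
      -- The crux: `t e < b e'` would order `e` before `e'` in the path, hence in `P`, although `e'`
      -- is started and `e` is not yet done at time `k`.
      · refine (hκ_lt k hk _).2 fun e' he' => not_lt.1 fun h => ?_
        have := (hprec' _ _).1 (hprec _ _ h)
        omega
      · rw [hκ_ge _ le_rfl]
        exact (hT e).1 ((hT' e).2 he))
    (by
      intro k hk
      rcases k.even_or_odd' with ⟨r, rfl | rfl⟩
      · refine Or.inl fun e he => ?_
        have := ht' e
        omega
      · have h : ∀ e, b' e ≤ 2 * r + 1 + 1 → b' e ≤ 2 * r + 1 := fun e he => by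
          have := hb' e
          omega
        refine Or.inr ⟨h, le_antisymm ?_ ?_⟩
        -- By parity `2 * r + 2` is still below the end `2 * N + 3`, so `κ` is given there by the
        -- supremum.
        · exact (hκ_lt _ (by omega) _).2 fun e he => hb _ e (h e he)
        · exact (hκ_lt _ hk _).2 fun e he => hb _ e (he.trans (Nat.le_succ _)))
    (by
      intro e e' h h1 h2
      rcases P.comparable e e' with rfl | k | k | k | k
      · exact (p.ev.P.evt_irrefl _ h).elim
      · exact absurd ((hprec' _ _).1 k) (not_lt.2 h2)
      · exact absurd ((hprec' _ _).1 k) (not_lt.2 h1)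
      · exact k
      -- Events concurrent in `P` are ordered by its event order, which the subsumption preserves;
      -- the opposite order would contradict that of the path.
      · have := hf.preserves_evt _ _ k (fun k => absurd ((hprec' _ _).1 k) (not_lt.2 h1))
          (fun k => absurd ((hprec' _ _).1 k) (not_lt.2 h2))
        exact (p.ev.P.evt_irrefl _ (p.ev.P.evt_trans _ _ _ h this)).elim)
  exact hc'.exists_path_iso (by rw [hc0, h0]) (by rw [hcn, hn]) hbN hS' hT' hprec'

/-- The ipomsets of the paths that lead from a set of cells to a set of cells form a language. -/
theorem isLanguage_of_faceSystem (Φ : FaceSystem F) (start accept : Set (Cell X)) :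
    Ipomset.IsLanguage {P : Ipomset Act | ∃ x ∈ start, ∃ y ∈ accept, ∃ p : HPath F X x y,
      Ipomset.mk p.ev.P = P} := by
  refine ⟨?_, fun P => ?_⟩
  · rintro _ ⟨x, -, y, -, p, rfl⟩
    exact p.isInterval
  · induction P using Quotient.inductionOn with | _ P
    rintro _ hP hPQ ⟨x, hx, y, hy, p, rfl⟩
    obtain ⟨q, hq⟩ := p.exists_iso_of_subsumed Φ hP hPQ
    exact ⟨x, hx, y, hy, q, Quotient.sound hq⟩

end Lang

theorem mainTheorem6 {Act : Type v} :
    (∀ H : HDA.{v, w} Act, Ipomset.IsLanguage H.Lang) ∧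
      (∀ H : IHDA.{v, w} Act, Ipomset.IsLanguage H.Lang) := by
  exact ⟨fun H => isLanguage_of_faceSystem (LoWord.faceSystem Act) H.start H.accept,
    fun H => isLanguage_of_faceSystem (IloWord.faceSystem Act) H.start H.accept⟩
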